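/- **Setting.** Let $k,n,\ell_m\ge 0$ and $d_{\rm pad}\ge 1$ be integers, $\ell=4k+n$, $m=2^{\ell_m}$, and let $\mathbb F=\mathbb F_{2^\ell}$, identified additively with $\mathbb Z_2^\ell$. Three parties $P_0,P_1,P_2$ take part; one of them (MO) owns a model and another one (FO) owns features. A node is an element $t\|l\|r\|\mathbf v\|c$ of $\mathbb F$ with $t,l,r,c\in\{0,1\}^k$ and $\mathbf v\in\{0,1\}^n$. A tree array is $\mathbf T\in\mathbb F^m$; a feature vector is $\mathbf X\in(\{0,1\}^k)^n$. Starting at node $\mathbf T[0]$, one moves $d_{\rm pad}$ times from the current node $t\|l\|r\|\mathbf v\|c$ to $\mathbf T[l]$ if $x<t$ and to $\mathbf T[r]$ otherwise, where $x=\bigoplus_j \mathbf v[j]\mathbf X[j]$ (indices are read modulo $m$). The functionality $\mathcal F_{\sf pdte}$ takes $\mathbf T$ from MO and $\mathbf X$ from FO and gives to FO alone the class $c$ of the last node. It allows abort: the adversary decides, after seeing the output of the corrupted party, which honest parties receive their output. **Secret sharing and functionalities.** A sharing $\langle x\rangle$ consists of $x_0+x_1+x_2=x$, where $P_i$ holds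 $(x_i,x_{i-1})$. Every functionality below takes the honest parties' shares (these determine the sharing), lets the adversary choose the corrupted party's shares of an output sharing, and lets it decide which honest parties get their answer. If some honest party has aborted, then all of them abort in the next call. The functionalities are: $\mathcal F_{\sf share}$ and $\mathcal F_{\sf recon}$ (sharing an input of one party, reconstruction to one party); $\mathcal F_{\sf open}$ (opening to all parties); $\mathcal F_{\sf rand}$ (sharing of a uniform element of $\mathbb F$); $\mathcal F_{\sf coin}$ (public uniform elements of $\mathbb F\setminus\{0\}$); $\mathcal F_{\sf mul}^{\mathbb F}$ (sharing of $xy+e$ with an error $e\in\mathbb F$ chosen by the adversary); $\mathcal F_{\sf CheckZero}$ (public test whether a shared element is $0$); $\mathcal F_{\sf 3pc}^{\mathbb F_2}$ (sharing of $g(x)$ for a public map $g$ on bit strings); $\mathcal F_{\sf os}$ (sharing of $\mathbf A[\mathit{idx}]+e$ for a shared array $\mathbf A$, a shared index $\mathit{idx}$ and an error $e$ chosen by the adversary). **Protocol $\Pi_{\sf pdte}$.** *MacCheck* of pairs $(\langle x_j\rangle,\langle\sigma_j\rangle)_{j\le N}$ under a shared key $\langle\alpha\rangle$: call $\mathcal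 F_{\sf rand}$ for $\langle r\rangle$, $\mathcal F_{\sf mul}^{\mathbb F}$ for $\langle\sigma_r\rangle$ from $\langle r\rangle,\langle\alpha\rangle$, and $\mathcal F_{\sf coin}$ for $\rho_1,\dots,\rho_N$; compute $\langle v\rangle=\langle r\rangle+\sum_j\rho_j\langle x_j\rangle$ and $\langle w\rangle=\langle\sigma_r\rangle+\sum_j\rho_j\langle\sigma_j\rangle$; open $v$; abort unless $\mathcal F_{\sf CheckZero}(\langle w\rangle-v\langle\alpha\rangle)$ answers true. *Setup:* MO shares $\mathbf T$; call $\mathcal F_{\sf rand}$ for $\langle\alpha\rangle$; compute $\langle\mathbf M[j]\rangle$ from $\langle\alpha\rangle,\langle\mathbf T[j]\rangle$ by $\mathcal F_{\sf mul}^{\mathbb F}$ for all $j$; run MacCheck on the $m$ pairs $(\mathbf T[j],\mathbf M[j])$. *Evaluation:* FO shares $\mathbf X$; the current node is $\langle\mathbf T[0]\rangle$. Then $d_{\rm pad}$ times: compute sharings of $x=\bigoplus_j\mathbf X[j]\mathbf v[j]$, of the bit $b=(x<t)$ and of $\mathit{idx}=r\oplus b(l\oplus r)$ by $\mathcal F_{\sf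 3pc}^{\mathbb F_2}$; apply $\mathcal F_{\sf os}$ to $\langle\mathit{idx}\rangle$ and $\langle\mathbf T\|\mathbf M\rangle$; the selected node becomes the current node, and its class becomes the result. Finally run MacCheck on the $d_{\rm pad}$ selected pairs, and reconstruct the result to FO. **Theorem.** There are a constant $C>0$ and a polynomial $p$ such that for all parameters as above and every $\lambda\ge 0$ with $\ell>\lambda$ the following holds. 1. (*Security.*) $\Pi_{\sf pdte}$ securely computes $\mathcal F_{\sf pdte}$ with abort, in the $(\mathcal F_{\sf 3pc}^{\mathbb F_2},\mathcal F_{\sf os},\mathcal F_{\sf coin},\mathcal F_{\sf rand},\mathcal F_{\sf open},\mathcal F_{\sf mul}^{\mathbb F},\mathcal F_{\sf CheckZero},\mathcal F_{\sf share},\mathcal F_{\sf recon})$-hybrid model, against a malicious adversary that statically corrupts at most one of the three parties, with statistical error $C/|\mathbb F|<C\cdot 2^{-\lambda}$. That is: for every choice of the corrupted party (or none) there is a simulator that talks with the adversary as a black box, once and without rewinding, and that uses at most $p(m+n+k+d_{\rm pad})$ random elements of $\mathbb F$ and $\mathbb F\setminus\{0\}$ and arithmetic operations and zero tests in $\mathbb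 F$, such that for every (computationally unbounded, randomised) adversary and all inputs $\mathbf T,\mathbf X$, the joint distributions of the adversary's view and the honest parties' outputs in the execution of $\Pi_{\sf pdte}$ and in the ideal process with $\mathcal F_{\sf pdte}$ have statistical distance at most $C/|\mathbb F|$. 2. (*Detection of errors.*) For every corrupted party, adversary and inputs, the probability that the adversary injects a nonzero additive error in some call of $\mathcal F_{\sf os}$ or $\mathcal F_{\sf mul}^{\mathbb F}$ and yet some honest party does not abort is at most $C/|\mathbb F|$. 3. (*Meaning of $\mathcal F_{\sf pdte}$.*) If $\mathbf T$ encodes a decision tree of depth less than $d_{\rm pad}$ with its root at position $0$ (an inner node testing $\mathbf X[i]<t$ is stored with $\mathbf v$ the $i$-th unit vector and with the positions of its left child, taken when the test is true, and of its right child; both children of a leaf are the leaf itself), then the output of $\mathcal F_{\sf pdte}$ on $\mathbf T,\mathbf X$ is the class that the decision tree assigns to $\mathbf X$. -/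

import Mathlib

open scoped BigOperators

noncomputable section

namespace Mostree

/-! ### Encoding of messages as finite strings of field elements -/

/-- An encoding of the values of a message type `α` as strings over the field `K`. -/
class Code (K : Type) [Field K] (α : Type) where
  enc : α → ℕ → K
  dec : (ℕ → K) → α
  dec_enc : ∀ a, dec (enc a) = a

section Codes

variable {K : Type} [Field K] [DecidableEq K]

instance : Code K Unit where
  enc _ _ := 0
  dec _ := ()
  dec_enc _ := rfl

instance : Code K K where
  enc a j := if j = 0 then a else 0
  dec s := s 0
  dec_enc a := by simp

instance : Code K Kˣ where
  enc a j := if j = 0 then (a : K) else 0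
  dec s := if h : s 0 = 0 then 1 else Units.mk0 (s 0) h
  dec_enc a := by simp

instance : Code K Bool where
  enc b j := if j = 0 ∧ b = true then 1 else 0
  dec s := decide (s 0 ≠ 0)
  dec_enc b := by cases b <;> simp

instance : Code K (ZMod 2) where
  enc b j := if j = 0 ∧ b = 1 then 1 else 0
  dec s := if s 0 = 0 then 0 else 1
  dec_enc b := by
    have h : b = 0 ∨ b = 1 := by revert b; decide
    rcases h with h | h <;> simp [h]

/-- Pairs are interleaved. -/
instance {α β : Type} [Code K α] [Code K β] : Code K (α × β) where
  enc p j := if j % 2 = 0 then Code.enc p.1 (j / 2) else Code.enc p.2 (j / 2)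
  dec s := (Code.dec fun j => s (2 * j), Code.dec fun j => s (2 * j + 1))
  dec_enc p := by
    have h (j : ℕ) : (2 * j + 1) / 2 = j := by omega
    simp [h, Code.dec_enc, Nat.add_mod]

/-- Tuples are interleaved. -/
instance {α : Type} [Code K α] (N : ℕ) : Code K (Fin N → α) where
  enc v j := if h : 0 < N then Code.enc (v ⟨j % N, Nat.mod_lt _ h⟩) (j / N) else 0
  dec s i := Code.dec fun j => s (i + N * j)
  dec_enc v := by
    funext i
    have hN : 0 < N := i.pos
    have h1 (j : ℕ) : ((i : ℕ) + N * j) % N = i := by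
      rw [Nat.add_mul_mod_self_left, Nat.mod_eq_of_lt i.isLt]
    have h2 (j : ℕ) : ((i : ℕ) + N * j) / N = j := by
      rw [Nat.add_mul_div_left _ _ hN, Nat.div_eq_of_lt i.isLt, Nat.zero_add]
    simp [hN, h1, h2, Code.dec_enc]

end Codes

/-! ### Replicated secret sharing

A sharing of `x` is a triple with `x = x 0 + x 1 + x 2`; party `i` holds `(x i, x (i - 1))`. -/

/-- What one party holds of a sharing. -/
abbrev Sh (G : Type) : Type := G × G

/-- Local (share-wise) application of a map; sharings are preserved when `f` is additive. -/
def Sh.map {G H : Type} (f : G → H) (a : Sh G) : Sh H := (f a.1, f a.2)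

/-- Two sharings regarded as one sharing of the pair. -/
def Sh.pair {G H : Type} (a : Sh G) (b : Sh H) : Sh (G × H) := ((a.1, b.1), (a.2, b.2))

/-- The share triple, read off from what the honest parties hold (`c` is the corrupted party). -/
def joined {G : Type} (c : Option (Fin 3)) (s : Fin 3 → Sh G) (j : Fin 3) : G :=
  if c = some j then (s (j + 1)).2 else (s j).1

/-- The secret that the honest parties' shares determine. -/
def secret {G : Type} [AddCommGroup G] (c : Option (Fin 3)) (s : Fin 3 → Sh G) : G :=
  ∑ j, joined c s j

/-- The sharing of `x` in which the corrupted party holds `a`. It is unique. When nobody is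
corrupted, `a` is what party `0` holds. -/
def shareOut {G : Type} [AddCommGroup G] (c : Option (Fin 3)) (x : G) (a : Sh G) (i : Fin 3) :
    Sh G :=
  let p : Fin 3 := c.getD 0
  let y : Fin 3 → G := fun j => if j = p then a.1 else if j = p - 1 then a.2 else x - a.1 - a.2
  (y i, y (i - 1))

/-! ### Ideal functionalities and the hybrid model -/

/-- A three-party ideal functionality over messages encoded in `K`. In a call it takes one input
from each party, sends a `Leak` to the adversary, takes a `Reply` from it, and answers the
parties. The inputs of the corrupted party `c` arrive in `Reply`. -/
structure Functionality (K : Type) [Field K] : Type 1 where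
  In : Type
  Out : Type
  Leak : Type
  Reply : Type
  codeLeak : Code K Leak
  codeReply : Code K Reply
  /-- The functionality's coins determine the leak and its answers as a function of the reply. -/
  run : (c : Option (Fin 3)) → (Fin 3 → In) → PMF (Leak × (Reply → Fin 3 → Out))
  /-- The reply that is used when no party is corrupted. -/
  passive : PMF Reply
  /-- The reply injects a nonzero additive error. -/
  tampers : Reply → Prop

/-- One call seen by the adversary: the leak, and its reply together with its decision which of
the parties receive their answer (the others receive `⊥`). -/
structure Event (K : Type) [Field K] : Type 1 where
  F : Functionality K
  leak : F.Leak
  reply : F.Reply × (Fin 3 → Bool)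

/-- An arbitrary randomised adversary, which recalls everything it saw and did. -/
abbrev Adversary (K : Type) [Field K] : Type 1 :=
  List (Event K) → (F : Functionality K) → F.Leak → PMF (F.Reply × (Fin 3 → Bool))

/-- One step of a protocol whose parties have local states in `St`: every party derives its input
to a functionality from its own state, and updates its own state by the answer (`none`: abort). -/
structure Step (K : Type) [Field K] (St : Type) : Type 1 where
  F : Functionality K
  inp : Fin 3 → St → F.In
  upd : Fin 3 → St → F.Out → Option St

/-- The reply to a leak; it is the passive one if nobody is corrupted. -/
def replyTo {K : Type} [Field K] (c : Option (Fin 3)) (A : Adversary K) (h : List (Event K))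
    (F : Functionality K) (y : F.Leak) : PMF (F.Reply × (Fin 3 → Bool)) :=
  match c with
  | none => F.passive.map fun r => (r, fun _ : Fin 3 => true)
  | some _ => A h F y

open Classical in
/-- Execution of a list of steps with corrupted party `c`, from history `h` and states `σ`
(`none`: the party has aborted). A call in which an honest party does not take part is never
answered, so that then all honest parties abort. The entry of `σ` at the corrupted party is
meaningless and never used. -/
def exec {K : Type} [Field K] {St : Type} [Inhabited St] (c : Option (Fin 3)) (A : Adversary K) :
    List (Step K St) → List (Event K) → (Fin 3 → Option St) →
      PMF (List (Event K) × (Fin 3 → Option St))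
  | [], h, σ => PMF.pure (h, σ)
  | s :: rest, h, σ =>
    if ∀ i, c ≠ some i → (σ i).isSome then
      (s.F.run c fun i => s.inp i ((σ i).getD default)).bind fun q =>
        (replyTo c A h s.F q.1).bind fun a =>
            exec c A rest (h ++ [⟨s.F, q.1, a⟩]) fun i =>
              if a.2 i = true then (σ i).bind fun st => s.upd i st (q.2 a.1 i) else none
    else PMF.pure (h, fun _ => none)

/-! ### The functionalities of the hybrid model -/

section Functionalities

variable (K : Type) [Field K] [Fintype K] [DecidableEq K]

/-- Sharing of an input of the party `dealer`. -/
def Fshare (G : Type) [AddCommGroup G] [Fintype G] [Code K G] (dealer : Fin 3) :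
    Functionality K where
  In := G
  Out := Sh G
  Leak := Unit
  Reply := G × Sh G
  codeLeak := inferInstance
  codeReply := inferInstance
  run c inp := PMF.pure
    ((), fun r => shareOut c (if c = some dealer then r.1 else inp dealer) r.2)
  passive := PMF.uniformOfFintype _
  tampers _ := False

/-- Reconstruction to the party `rcv` alone. -/
def Frecon (G : Type) [AddCommGroup G] [Code K G] (rcv : Fin 3) : Functionality K where
  In := Sh G
  Out := Option G
  Leak := G
  Reply := Unit
  codeLeak := inferInstance
  codeReply := inferInstance
  run c inp := PMF.pure
    (if c = some rcv then secret c inp else 0,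
      fun _ i => if i = rcv then some (secret c inp) else none)
  passive := PMF.pure ()
  tampers _ := False

/-- Opening to all parties. -/
def Fopen : Functionality K where
  In := Sh K
  Out := K
  Leak := K
  Reply := Unit
  codeLeak := inferInstance
  codeReply := inferInstance
  run c inp := PMF.pure (secret c inp, fun _ _ => secret c inp)
  passive := PMF.pure ()
  tampers _ := False

/-- Sharing of a uniformly random field element. -/
def Frand : Functionality K where
  In := Unit
  Out := Sh K
  Leak := Unit
  Reply := Sh K
  codeLeak := inferInstance
  codeReply := inferInstance
  run c _ := (PMF.uniformOfFintype K).map fun x => ((), shareOut c x)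
  passive := PMF.uniformOfFintype _
  tampers _ := False

/-- `N` public uniformly random nonzero field elements. -/
def Fcoin (N : ℕ) : Functionality K where
  In := Unit
  Out := Fin N → Kˣ
  Leak := Fin N → Kˣ
  Reply := Unit
  codeLeak := inferInstance
  codeReply := inferInstance
  run _ _ := (PMF.uniformOfFintype (Fin N → Kˣ)).map fun ρ => (ρ, fun _ _ => ρ)
  passive := PMF.pure ()
  tampers _ := False

/-- `N` parallel multiplications in `K`, each up to an additive error of the adversary. -/
def Fmul (N : ℕ) : Functionality K where
  In := Fin N → Sh K × Sh K
  Out := Fin N → Sh K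
  Leak := Unit
  Reply := (Fin N → K) × (Fin N → Sh K)
  codeLeak := inferInstance
  codeReply := inferInstance
  run c inp := PMF.pure ((), fun r i j => shareOut c
    (secret c (fun p => (inp p j).1) * secret c (fun p => (inp p j).2) + r.1 j) (r.2 j) i)
  passive := (PMF.uniformOfFintype (Fin N → Sh K)).map fun a => (0, a)
  tampers r := r.1 ≠ 0

/-- Public test whether a shared field element is zero. -/
def FcheckZero : Functionality K where
  In := Sh K
  Out := Bool
  Leak := Bool
  Reply := Unit
  codeLeak := inferInstance
  codeReply := inferInstance
  run c inp := PMF.pure (decide (secret c inp = 0), fun _ _ => decide (secret c inp = 0))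
  passive := PMF.pure ()
  tampers _ := False

/-- Secure computation of a map `g` between spaces of bit strings, without errors. -/
def F3pc {U V : Type} [AddCommGroup U] [AddCommGroup V] [Module (ZMod 2) U] [Module (ZMod 2) V]
    [Fintype V] [Code K V] (g : U → V) : Functionality K where
  In := Sh U
  Out := Sh V
  Leak := Unit
  Reply := Sh V
  codeLeak := inferInstance
  codeReply := inferInstance
  run c inp := PMF.pure ((), shareOut c (g (secret c inp)))
  passive := PMF.uniformOfFintype _
  tampers _ := False

/-- Oblivious selection from a shared array at a shared index, up to an additive error of the
adversary; `ix` reads an index value as a position. -/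
def Fos (I G : Type) [AddCommGroup I] [AddCommGroup G] [Fintype G] [Code K G] (m : ℕ)
    (ix : I → Fin m) : Functionality K where
  In := Sh I × (Fin m → Sh G)
  Out := Sh G
  Leak := Unit
  Reply := G × Sh G
  codeLeak := inferInstance
  codeReply := inferInstance
  run c inp := PMF.pure ((), fun r => shareOut c
    (secret c (fun p => (inp p).2 (ix (secret c fun p => (inp p).1))) + r.1) r.2)
  passive := (PMF.uniformOfFintype (Sh G)).map fun a => (0, a)
  tampers r := r.1 ≠ 0

end Functionalities

/-! ### Decision trees and their evaluation -/

/-- `k`-bit strings, with bitwise XOR as addition. -/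
abbrev Word (k : ℕ) : Type := Fin k → ZMod 2

/-- The number with the given binary digits (least significant digit first). -/
def Word.val {k : ℕ} (w : Word k) : ℕ := ∑ i, (w i).val * 2 ^ (i : ℕ)

/-- The public parameters: bit length `k` of values, dimension `n` of feature vectors, `2 ^ lm`
entries of the tree array, number `dpad` of iterations, the additive identification of the field
with the `4 k + n`-bit nodes, and the parties that own the model and the features. -/
structure Setting (K : Type) [Field K] where
  k : ℕ
  n : ℕ
  lm : ℕ
  dpad : ℕ
  dpad_pos : 0 < dpad
  bits : K ≃+ (Fin (4 * k + n) → ZMod 2)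
  mo : Fin 3
  fo : Fin 3
  mo_ne_fo : mo ≠ fo

namespace Setting

variable {K : Type} [Field K] (S : Setting K)

/-- The bit length of tree nodes. -/
def ell : ℕ := 4 * S.k + S.n

/-- The length of the tree array. -/
abbrev m : ℕ := 2 ^ S.lm

/-- A feature vector. -/
abbrev Features : Type := Fin S.n → Word S.k

/-- A tree array. -/
abbrev TreeArray : Type := Fin S.m → K

/-- The position in the array that an index denotes (its low `lm` bits). -/
def pos (w : Word S.k) : Fin S.m := ⟨w.val % 2 ^ S.lm, Nat.mod_lt _ (Nat.two_pow_pos _)⟩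

/- A node is the concatenation `t ‖ l ‖ r ‖ v ‖ c` of threshold, left and right child, unit vector
of the feature index, and class. -/

def thr (x : K) : Word S.k := fun i => S.bits x ⟨i, by omega⟩
def left (x : K) : Word S.k := fun i => S.bits x ⟨S.k + i, by omega⟩
def right (x : K) : Word S.k := fun i => S.bits x ⟨2 * S.k + i, by omega⟩
def sel (x : K) : Fin S.n → ZMod 2 := fun i => S.bits x ⟨3 * S.k + i, by omega⟩
def cls (x : K) : Word S.k := fun i => S.bits x ⟨3 * S.k + S.n + i, by omega⟩

/-- `∑ j, X j · v j` over `𝔽₂`. -/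
def innerProd (q : S.Features × (Fin S.n → ZMod 2)) : Word S.k := ∑ j, q.2 j • q.1 j

/-- The bit `x < t`. -/
def less (q : Word S.k × Word S.k) : ZMod 2 := if q.1.val < q.2.val then 1 else 0

/-- `r ⊕ b · (l ⊕ r)`. -/
def mux (q : ZMod 2 × Word S.k × Word S.k) : Word S.k := q.2.2 + q.1 • (q.2.1 + q.2.2)

/-- The node reached after `j` comparisons, starting at position `0`. -/
def walk (T : S.TreeArray) (X : S.Features) : ℕ → K
  | 0 => T ⟨0, Nat.two_pow_pos _⟩
  | j + 1 =>
    let x := walk T X j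
    T (S.pos (if (S.innerProd (X, S.sel x)).val < (S.thr x).val then S.left x else S.right x))

/-- The function that the decision-tree evaluation functionality computes. -/
def pdte (T : S.TreeArray) (X : S.Features) : Word S.k := S.cls (S.walk T X S.dpad)

end Setting

/-- Decision trees with `k`-bit thresholds and classes over `n` features. -/
inductive DTree (k n : ℕ) : Type
  | leaf (c : Word k) : DTree k n
  | node (t : Word k) (v : Fin n) (l r : DTree k n) : DTree k n

/-- The classification of a feature vector by a decision tree. -/
def DTree.classify {k n : ℕ} (X : Fin n → Word k) : DTree k n → Word k
  | .leaf c => c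
  | .node t v l r => if (X v).val < t.val then l.classify X else r.classify X

def DTree.depth {k n : ℕ} : DTree k n → ℕ
  | .leaf _ => 0
  | .node _ _ l r => max l.depth r.depth + 1

/-- The array holds the given tree with its root at position `i`; the children of a leaf are the
leaf itself. -/
def Setting.Encodes {K : Type} [Field K] (S : Setting K) (T : S.TreeArray) :
    DTree S.k S.n → Fin S.m → Prop
  | .leaf c, i => S.cls (T i) = c ∧ (S.left (T i)).val = i ∧ (S.right (T i)).val = i
  | .node t v l r, i => S.thr (T i) = t ∧ S.sel (T i) = Pi.single v 1 ∧
      ∃ a b : Fin S.m, (S.left (T i)).val = a ∧ (S.right (T i)).val = b ∧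
        S.Encodes T l a ∧ S.Encodes T r b

/-! ### The protocol -/

/-- The local state of a party. -/
structure PState {K : Type} [Field K] (S : Setting K) : Type where
  /-- The input of the model owner. -/
  inT : S.TreeArray
  /-- The input of the feature owner. -/
  inX : S.Features
  T : Fin S.m → Sh K
  M : Fin S.m → Sh K
  X : Sh S.Features
  /-- The MAC key. -/
  key : Sh K
  /-- The mask of a MAC check, its MAC, the two random combinations, and the opened value. -/
  r : Sh K
  sr : Sh K
  v : Sh K
  w : Sh K
  vOpen : K
  /-- The node at hand. -/
  node : Sh K
  x : Sh (Word S.k)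
  b : Sh (ZMod 2)
  idx : Sh (Word S.k)
  /-- The selected pairs of nodes and MACs. -/
  picked : Fin S.dpad → Sh K × Sh K
  result : Sh (Word S.k)
  output : Option (Word S.k)

instance {K : Type} [Field K] (S : Setting K) : Inhabited (PState S) :=
  ⟨⟨0, 0, 0, 0, 0, 0, 0, 0, 0, 0, 0, 0, 0, 0, 0, 0, 0, none⟩⟩

section Protocol

variable {K : Type} [Field K] [Fintype K] [DecidableEq K] (S : Setting K)

/-- The batch MAC check of the `N` pairs (value, MAC) that `get` finds in the state. -/
def macCheck (N : ℕ) (get : PState S → Fin N → Sh K × Sh K) : List (Step K (PState S)) :=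
  [ { F := Frand K
      inp := fun _ _ => ()
      upd := fun _ s o => some { s with r := o } },
    { F := Fmul K 1
      inp := fun _ s _ => (s.r, s.key)
      upd := fun _ s o => some { s with sr := o 0 } },
    { F := Fcoin K N
      inp := fun _ _ => ()
      upd := fun _ s ρ => some { s with
        v := s.r + ∑ j, (ρ j : K) • (get s j).1
        w := s.sr + ∑ j, (ρ j : K) • (get s j).2 } },
    { F := Fopen K
      inp := fun _ s => s.v
      upd := fun _ s o => some { s with vOpen := o } },
    { F := FcheckZero K
      inp := fun _ s => s.w - s.vOpen • s.key
      upd := fun _ s (ok : Bool) => if ok then some s else none } ]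

/-- The setup phase. -/
def setupSteps : List (Step K (PState S)) :=
  [ { F := Fshare K S.TreeArray S.mo
      inp := fun _ s => s.inT
      upd := fun _ s o => some { s with T := fun j => o.map fun a => a j } },
    { F := Frand K
      inp := fun _ _ => ()
      upd := fun _ s o => some { s with key := o } },
    { F := Fmul K S.m
      inp := fun _ s j => (s.key, s.T j)
      upd := fun _ s o => some { s with M := o } } ]
  ++ macCheck S S.m fun s j => (s.T j, s.M j)

/-- Iteration `j` of the evaluation phase. -/
def iteration (j : Fin S.dpad) : List (Step K (PState S)) :=
  [ { F := F3pc K S.innerProd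
      inp := fun _ s => s.X.pair (s.node.map S.sel)
      upd := fun _ s o => some { s with x := o } },
    { F := F3pc K S.less
      inp := fun _ s => s.x.pair (s.node.map S.thr)
      upd := fun _ s o => some { s with b := o } },
    { F := F3pc K S.mux
      inp := fun _ s => s.b.pair ((s.node.map S.left).pair (s.node.map S.right))
      upd := fun _ s o => some { s with idx := o } },
    { F := Fos K (Word S.k) (K × K) S.m S.pos
      inp := fun _ s => (s.idx, fun i => (s.T i).pair (s.M i))
      upd := fun _ s o => some { s with
        node := o.map Prod.fst
        picked := Function.update s.picked j (o.map Prod.fst, o.map Prod.snd)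
        result := o.map fun a => S.cls a.1 } } ]

/-- The evaluation phase. -/
def evalSteps : List (Step K (PState S)) :=
  [ { F := Fshare K S.Features S.fo
      inp := fun _ s => s.inX
      upd := fun _ s o => some { s with X := o, node := s.T ⟨0, Nat.two_pow_pos _⟩ } } ]
  ++ (List.finRange S.dpad).flatMap (iteration S)
  ++ macCheck S S.dpad (fun s j => s.picked j)
  ++ [ { F := Frecon K (Word S.k) S.fo
         inp := fun _ s => s.result
         upd := fun _ s o => some { s with output := o } } ]

/-- The protocol: setup followed by evaluation. -/
def protocol : List (Step K (PState S)) := setupSteps S ++ evalSteps S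

/-- The initial state of party `i`: it knows its own input only. -/
def initial (T : S.TreeArray) (X : S.Features) (i : Fin 3) : PState S :=
  { (default : PState S) with
    inT := if i = S.mo then T else 0
    inX := if i = S.fo then X else 0 }

end Protocol

/-! ### The real and the ideal process -/

/-- How a party ends: by aborting, without an output, or with an output. -/
inductive Outcome (W : Type) : Type
  | aborted : Outcome W
  | done : Outcome W
  | result (w : W) : Outcome W

/-- The view of the adversary, and how the honest parties end (the entry of the corrupted party is
the constant `done`). -/
abbrev Record {K : Type} [Field K] (S : Setting K) : Type 1 :=
  List (Event K) × (Fin 3 → Outcome (Word S.k))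

open Classical in
/-- The hybrid-model process. When nobody is corrupted, the adversary has no view. -/
def real {K : Type} [Field K] [Fintype K] [DecidableEq K] (S : Setting K) (c : Option (Fin 3))
    (A : Adversary K) (T : S.TreeArray) (X : S.Features) : PMF (Record S) :=
  (exec c A (protocol S) [] fun i => some (initial S T X i)).map fun q =>
    (if c = none then [] else q.1,
      fun i => if c = some i then .done else
        match q.2 i with
        | none => .aborted
        | some s =>
          match s.output with
          | none => .done
          | some w => .result w)

/-- Arithmetic formulas with zero tests over `K`, from which a simulator is built. -/
inductive Expr (K : Type) : Type
  | const (a : K) : Expr K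
  /-- A uniformly random field element of the random tape. -/
  | coin (i : ℕ) : Expr K
  /-- A uniformly random nonzero field element of the random tape. -/
  | unitCoin (i : ℕ) : Expr K
  /-- Coordinate `j` of the adversary's message in call number `t`. -/
  | msg (t j : ℕ) : Expr K
  /-- Coordinate `j` of the corrupted party's output from the ideal functionality. -/
  | out (j : ℕ) : Expr K
  | add (e f : Expr K) : Expr K
  | mul (e f : Expr K) : Expr K
  /-- `f` if `e` is zero, otherwise `g`. -/
  | ifZero (e f g : Expr K) : Expr K

def Expr.size {K : Type} : Expr K → ℕ
  | .const _ | .coin _ | .unitCoin _ | .msg _ _ | .out _ => 1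
  | .add e f | .mul e f => e.size + f.size + 1
  | .ifZero e f g => e.size + f.size + g.size + 1

/-- What a simulator has access to. -/
structure Env (K : Type) [Field K] : Type 1 where
  coin : ℕ → K
  unitCoin : ℕ → K
  hist : List (Event K)
  out : ℕ → K

open Classical in
def Expr.eval {K : Type} [Field K] (E : Env K) : Expr K → K
  | .const a => a
  | .coin i => E.coin i
  | .unitCoin i => E.unitCoin i
  | .msg t j =>
    match E.hist[t]? with
    | none => 0
    | some e =>
      haveI := e.F.codeReply
      Code.enc e.reply j
  | .out j => E.out j
  | .add e f => e.eval E + f.eval E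
  | .mul e f => e.eval E * f.eval E
  | .ifZero e f g => if e.eval E = 0 then f.eval E else g.eval E

/-- The string of the values of a list of formulas. -/
def evalList {K : Type} [Field K] (E : Env K) (es : List (Expr K)) (j : ℕ) : K :=
  match es[j]? with
  | none => 0
  | some e => e.eval E

/-- A straight-line black-box simulator: it talks once with the adversary, playing the
functionalities. In call number `t < rounds` it stops if `halt t` is not zero, and otherwise sends
the leak that `leak t` encodes. After `query` calls it submits the input of the corrupted party
and obtains the output of that party. At the end it decides by `deliver i` whether the
functionality gives honest party `i` its output. -/
structure Simulator (K : Type) where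
  coins : ℕ
  query : ℕ
  halt : ℕ → Expr K
  leak : ℕ → List (Expr K)
  input : List (Expr K)
  deliver : Fin 3 → Expr K

/-- The number of coins and of operations of a simulator in a conversation of `rounds` calls. -/
def Simulator.size {K : Type} (sim : Simulator K) (rounds : ℕ) : ℕ :=
  sim.coins
    + ∑ t ∈ Finset.range rounds, ((sim.halt t).size + ((sim.leak t).map Expr.size).sum)
    + (sim.input.map Expr.size).sum + ∑ i, (sim.deliver i).size

open Classical in
/-- The conversation of simulator and adversary about a list of calls. The second component of the
result tells whether it went through to the end. -/
def chat {K : Type} [Field K] (sim : Simulator K) (A : Adversary K) (coin unitCoin out : ℕ → K) :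
    List (Functionality K) → List (Event K) → PMF (List (Event K) × Bool)
  | [], h => PMF.pure (h, true)
  | F :: rest, h =>
    let E : Env K := ⟨coin, unitCoin, h, out⟩
    if (sim.halt h.length).eval E = 0 then
      haveI := F.codeLeak
      let y : F.Leak := Code.dec (evalList E (sim.leak h.length))
      (A h F y).bind fun a => chat sim A coin unitCoin out rest (h ++ [⟨F, y, a⟩])
    else PMF.pure (h, false)

open Classical in
/-- The ideal process with the functionality that takes a tree array from the model owner and a
feature vector from the feature owner, and gives the classification to the feature owner, where
the adversary may withhold the outputs of honest parties after it saw its own. -/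
def ideal {K : Type} [Field K] [Fintype K] [DecidableEq K] (S : Setting K) (c : Option (Fin 3))
    (sim : Simulator K) (A : Adversary K) (T : S.TreeArray) (X : S.Features) : PMF (Record S) :=
  match c with
  | none => PMF.pure ([], fun i => if i = S.fo then .result (S.pdte T X) else .done)
  | some p =>
    let calls : List (Functionality K) := (protocol S).map Step.F
    (PMF.uniformOfFintype ((Fin sim.coins → K) × (Fin sim.coins → Kˣ))).bind fun tape =>
      let coin : ℕ → K := fun i => if h : i < sim.coins then tape.1 ⟨i, h⟩ else 0
      let unitCoin : ℕ → K := fun i => if h : i < sim.coins then (tape.2 ⟨i, h⟩ : K) else 0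
      (chat sim A coin unitCoin (fun _ => 0) (calls.take sim.query) []).bind fun q₁ =>
        if q₁.2 = false then
          PMF.pure (q₁.1, fun i => if i = p then .done else .aborted)
        else
          let given : ℕ → K := evalList ⟨coin, unitCoin, q₁.1, fun _ => 0⟩ sim.input
          let T' : S.TreeArray := if p = S.mo then Code.dec given else T
          let X' : S.Features := if p = S.fo then Code.dec given else X
          let out : ℕ → K := if p = S.fo then Code.enc (S.pdte T' X') else fun _ => 0
          (chat sim A coin unitCoin out (calls.drop sim.query) q₁.1).map fun q₂ =>
            (q₂.1, fun i =>
              if i = p then .done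
              else if (sim.deliver i).eval ⟨coin, unitCoin, q₂.1, out⟩ = 0 then .aborted
              else if i = S.fo then .result (S.pdte T' X') else .done)

/-- Statistical distance at most `ε`. -/
def StatClose {Ω : Type*} (ε : ℝ) (p q : PMF Ω) : Prop :=
  ∀ D : Set Ω, |(p.toOuterMeasure D).toReal - (q.toOuterMeasure D).toReal| ≤ ε

/-- Security with abort against a malicious adversary that corrupts at most one of the three
parties, with statistical error `ε` and a simulator of the given size. -/
def SecurelyComputes {K : Type} [Field K] [Fintype K] [DecidableEq K] (S : Setting K) (size : ℕ)
    (ε : ℝ) : Prop :=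
  ∀ c : Option (Fin 3), ∃ sim : Simulator K, sim.size (protocol S).length ≤ size ∧
    ∀ (A : Adversary K) (T : S.TreeArray) (X : S.Features),
      StatClose ε (real S c A T X) (ideal S c sim A T X)

/-- The adversary injects a nonzero additive error, and yet some honest party does not abort. -/
def undetected {K : Type} [Field K] (S : Setting K) (c : Fin 3) : Set (Record S) :=
  {q | (∃ e ∈ q.1, e.F.tampers e.reply.1) ∧ ∃ i, i ≠ c ∧ q.2 i ≠ .aborted}

end Mostree

end

open scoped BigOperators ENNReal

set_option linter.unusedSectionVars false

noncomputable section

namespace Mostree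

/-! ### One-sided closeness of distributions -/

section Within

variable {Ω Ω' : Type*}

/-! No functionality shows the adversary an honest share, and the corrupted party picks its own
shares. So the view of the adversary, and whether honest parties abort, depend on the shared secrets
alone. By linearity of `secret`, the execution becomes a process on the tuple of secrets
(`exec_eq_play`), whose only hidden random quantities are the MAC key α and the masks r of the two
checks.

The core is a single MAC check (`mac_within`). All errors are additive, so before a check the pairs
satisfy σ_j = α x_j + ε_j − α δ_j, where δ and ε are determined by the replies of the adversary and
vanish exactly when there was no tampering. If e is the error on the MAC of r, then the value tested
for zero is e + ∑ ρ_j ε_j − α ∑ ρ_j δ_j: an affine form in α in which r and the x_j have cancelled.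
The errors are fixed before ρ is drawn. Hence, with q = |K|, if some error is nonzero then both
coefficients of the form vanish with probability at most 1/(q−1) ≤ 2/q (`unif_linear_le`), and
otherwise α is a root with probability at most 1/q (`unif_affine_le`). The opened value r + ∑ ρ_j
x_j is uniform whatever α is, thanks to the mask. So, at a cost of 3/q, a check may be replaced by
public random ρ and v with the verdict "no error so far". After a positive verdict α is still
uniform given all that is visible, so the second check can be treated in the same way.

Between the checks the MACs in the array are correct. A selection with errors (e₁, e₂) then yields a
pair with δ = e₁ and ε = e₂, and a node that may be wrong but does not depend on α (`Iterated`).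
Without errors it is the node of the true walk.

This gives the hybrid process, within 6/q of the execution (`real_within_hybrid`). There, undetected
errors do not occur (`hybrid_undetected`), which proves the second claim. Its leaks are computable
from the messages of the adversary, public coins and the output of `pdte` on inputs read off those
messages. A simulator can therefore reproduce it exactly (`ideal_eq_hybrid`); an uncorrupted run is
deterministic in its outcome (`real_honest`). The third claim is an induction on the tree
(`cls_walkFrom`). -/

/-- Every event is at most `ε` more likely under `p` than under `q`. -/
def Within (ε : ℝ≥0∞) (p q : PMF Ω) : Prop :=
  ∀ D : Set Ω, p.toOuterMeasure D ≤ q.toOuterMeasure D + ε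

theorem pmf_le_one (p : PMF Ω) (D : Set Ω) : p.toOuterMeasure D ≤ 1 := by
  rw [PMF.toOuterMeasure_apply, ← p.tsum_coe]
  exact ENNReal.tsum_le_tsum fun x => Set.indicator_le_self _ _ x

theorem pmf_add_compl (p : PMF Ω) (D : Set Ω) :
    p.toOuterMeasure D + p.toOuterMeasure Dᶜ = 1 := by
  rw [PMF.toOuterMeasure_apply, PMF.toOuterMeasure_apply, ← ENNReal.tsum_add, ← p.tsum_coe]
  congr 1
  funext x
  by_cases h : x ∈ D <;> simp [h]

/-- The reverse inequality is the one-sided bound for the complementary event, since the two masses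
add up to 1. -/
theorem Within.statClose {ε : ℝ} (hε : 0 ≤ ε) {p q : PMF Ω}
    (h : Within (ENNReal.ofReal ε) p q) : StatClose ε p q := by
  have ne (p : PMF Ω) (D : Set Ω) : p.toOuterMeasure D ≠ ∞ :=
    ((pmf_le_one p D).trans_lt ENNReal.one_lt_top).ne
  have key (D : Set Ω) : (p.toOuterMeasure D).toReal ≤ (q.toOuterMeasure D).toReal + ε := by
    have h1 := ENNReal.toReal_mono (ENNReal.add_ne_top.2 ⟨ne q D, ENNReal.ofReal_ne_top⟩) (h D)
    rwa [ENNReal.toReal_add (ne q D) ENNReal.ofReal_ne_top, ENNReal.toReal_ofReal hε] at h1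
  have compl (p : PMF Ω) (D : Set Ω) :
      (p.toOuterMeasure D).toReal + (p.toOuterMeasure Dᶜ).toReal = 1 := by
    rw [← ENNReal.toReal_add (ne p D) (ne p _), pmf_add_compl, ENNReal.toReal_one]
  intro D
  rw [abs_le]
  constructor <;> linarith [key D, key Dᶜ, compl p D, compl q D]

theorem Within.refl (p : PMF Ω) : Within 0 p p := fun D => by simp

theorem Within.of_eq {p q : PMF Ω} (h : p = q) (ε : ℝ≥0∞) : Within ε p q := fun D => by
  rw [h]; exact le_self_add

theorem Within.mono {ε ε' : ℝ≥0∞} {p q : PMF Ω} (h : Within ε p q) (hε : ε ≤ ε') :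
    Within ε' p q := fun D => (h D).trans (by gcongr)

/-- Off `B` the continuations are compared pointwise; on `B` the left one is bounded by 1, which
costs the mass of `B` once. -/
theorem within_bind_of_bad {ε δ : ℝ≥0∞} (p : PMF Ω') {f g : Ω' → PMF Ω} (B : Set Ω')
    (h : ∀ x, x ∉ B → Within ε (f x) (g x)) (hB : p.toOuterMeasure B ≤ δ) :
    Within (ε + δ) (p.bind f) (p.bind g) := by
  intro D
  rw [PMF.toOuterMeasure_bind_apply, PMF.toOuterMeasure_bind_apply]
  calc ∑' a, p a * (f a).toOuterMeasure D
      ≤ ∑' a, (p a * (g a).toOuterMeasure D + (p a * ε + B.indicator p a)) := by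
        refine ENNReal.tsum_le_tsum fun a => ?_
        by_cases ha : a ∈ B
        · rw [Set.indicator_of_mem ha]
          calc p a * (f a).toOuterMeasure D ≤ p a * 1 := by gcongr; exact pmf_le_one _ _
            _ = p a := mul_one _
            _ ≤ _ := by rw [← add_assoc]; exact le_add_self
        · rw [Set.indicator_of_notMem ha, add_zero, ← mul_add]
          gcongr
          exact h a ha D
    _ = ∑' a, p a * (g a).toOuterMeasure D + (ε + p.toOuterMeasure B) := by
        rw [ENNReal.tsum_add, ENNReal.tsum_add, ENNReal.tsum_mul_right, p.tsum_coe, one_mul,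
          PMF.toOuterMeasure_apply]
    _ ≤ _ := by gcongr

theorem within_bind {ε : ℝ≥0∞} (p : PMF Ω') {f g : Ω' → PMF Ω}
    (h : ∀ x, Within ε (f x) (g x)) : Within ε (p.bind f) (p.bind g) := by
  have := within_bind_of_bad (ε := ε) (δ := 0) p (f := f) (g := g) ∅ (fun x _ => h x) (by simp)
  simpa using this

/-- A hidden average on the left can be moved behind a common visible sample. -/
theorem within_bind_comm {Ω₁ Ω₂ : Type*} {ε : ℝ≥0∞} (p : PMF Ω₁) (s : PMF Ω₂)
    {f : Ω₁ → Ω₂ → PMF Ω} {g : Ω₂ → PMF Ω} (h : ∀ a, Within ε (p.bind fun x => f x a) (g a)) :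
    Within ε (p.bind fun x => s.bind fun a => f x a) (s.bind g) := by
  rw [PMF.bind_comm]
  exact within_bind s h

end Within

/-! ### Uniform distributions -/

section Uniform

/-- The uniform distribution on a finite nonempty type. -/
abbrev unif (α : Type) [Fintype α] [Nonempty α] : PMF α := PMF.uniformOfFintype α

variable {α β : Type} [Fintype α] [Nonempty α] [Fintype β] [Nonempty β] {Ω : Type*}

theorem unif_map_equiv (e : α ≃ β) : (unif α).map e = unif β := by
  classical
  ext b
  rw [PMF.map_apply, tsum_eq_single (e.symm b)]
  · simp [Fintype.card_congr e]
  · intro a ha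
    rw [if_neg]
    rintro rfl
    simp at ha

theorem unif_bind_equiv (e : α ≃ β) (f : β → PMF Ω) :
    ((unif α).bind fun a => f (e a)) = (unif β).bind f := by
  rw [← unif_map_equiv e, PMF.bind_map]
  rfl

theorem unif_prod_bind (f : α × β → PMF Ω) :
    (unif (α × β)).bind f = (unif α).bind fun a => (unif β).bind fun b => f (a, b) := by
  ext x
  simp only [PMF.bind_apply, PMF.uniformOfFintype_apply, tsum_fintype, Fintype.sum_prod_type,
    Fintype.card_prod, Nat.cast_mul, Finset.mul_sum]
  refine Finset.sum_congr rfl fun a _ => Finset.sum_congr rfl fun b _ => ?_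
  rw [ENNReal.mul_inv (by simp) (by simp), mul_assoc]

theorem unif_shift {G : Type} [AddGroup G] [Fintype G] (c : G) (f : G → PMF Ω) :
    ((unif G).bind fun x => f (x + c)) = (unif G).bind f :=
  unif_bind_equiv (Equiv.addRight c) f

theorem unif_measure_le {B : Set α} {a b : ℕ} (hb : b ≠ 0)
    (h : Nat.card B * b ≤ a * Fintype.card α) :
    (unif α).toOuterMeasure B ≤ (a : ℝ≥0∞) / b := by
  classical
  rw [PMF.toOuterMeasure_uniformOfFintype_apply, ENNReal.div_le_iff_le_mul (by simp) (by simp),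
    div_eq_mul_inv, mul_right_comm, ← div_eq_mul_inv, ENNReal.le_div_iff_mul_le (by simp [hb]) (by simp)]
  rw [Nat.card_eq_fintype_card] at h
  exact_mod_cast h

end Uniform

/-! ### Random linear combinations -/

section Counting

variable {K : Type} [Field K] [Fintype K] [DecidableEq K]

/-- A nontrivial affine form rarely vanishes at random nonzero coefficients. -/
theorem unif_linear_le {N : ℕ} (e : K) (d : Fin N → K) (hd : d ≠ 0) :
    (unif (Fin N → Kˣ)).toOuterMeasure {ρ | e + ∑ j, (ρ j : K) * d j = 0}
      ≤ (2 : ℕ) / (Fintype.card K : ℕ) := by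
  classical
  refine unif_measure_le Fintype.card_ne_zero ?_
  obtain ⟨i, hi⟩ := Function.ne_iff.1 hd
  let B : Set (Fin N → Kˣ) := {ρ | e + ∑ j, (ρ j : K) * d j = 0}
  -- For ρ in `B` the equation recovers ρ i from the other coordinates, because d i ≠ 0. That
  -- coordinate is free to store an arbitrary unit, so |B| (q − 1) ≤ (q − 1)^N.
  have inj : Function.Injective fun q : B × Kˣ => Function.update q.1.1 i q.2 := by
    rintro ⟨⟨ρ, hρ⟩, x⟩ ⟨⟨ρ', hρ'⟩, x'⟩ h
    have hx : x = x' := by simpa using congrFun h i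
    have off (j : Fin N) (hj : j ≠ i) : ρ j = ρ' j := by simpa [hj] using congrFun h j
    have on : ρ i = ρ' i := by
      have h1 : e + ∑ j, (ρ j : K) * d j = e + ∑ j, (ρ' j : K) * d j := by
        rw [show _ = (0 : K) from hρ, show _ = (0 : K) from hρ']
      rw [← Finset.add_sum_erase _ _ (Finset.mem_univ i),
        ← Finset.add_sum_erase _ _ (Finset.mem_univ i),
        Finset.sum_congr rfl fun j hj => by rw [off j (Finset.ne_of_mem_erase hj)]] at h1
      exact Units.ext (mul_right_cancel₀ hi (add_right_cancel (add_left_cancel h1)))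
    have : ρ = ρ' := by
      funext j
      by_cases hj : j = i
      · rw [hj, on]
      · exact off j hj
    subst this hx
    rfl
  have h1 := Fintype.card_le_of_injective _ inj
  rw [Fintype.card_prod, Fintype.card_units] at h1
  have hq : 1 < Fintype.card K := Fintype.one_lt_card
  rw [Nat.card_eq_fintype_card]
  -- Nonzero coefficients give 1/(q − 1); the factor 2 turns this into 2/q by q ≤ 2(q − 1).
  calc Fintype.card B * Fintype.card K ≤ Fintype.card B * (2 * (Fintype.card K - 1)) := by
        gcongr; omega
    _ = 2 * (Fintype.card B * (Fintype.card K - 1)) := by ring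
    _ ≤ _ := by gcongr

/-- There is at most one root: for b = 0 the form is a nonzero constant, and for b ≠ 0 the root is
unique. -/
theorem unif_affine_le (a b : K) (h : ¬(a = 0 ∧ b = 0)) :
    (unif K).toOuterMeasure {x | a - x * b = 0} ≤ (1 : ℕ) / (Fintype.card K : ℕ) := by
  refine unif_measure_le Fintype.card_ne_zero ?_
  gcongr
  rw [Nat.card_eq_fintype_card, Fintype.card_le_one_iff_subsingleton]
  constructor
  rintro ⟨x, hx⟩ ⟨y, hy⟩
  have hx' : a - x * b = 0 := hx
  have hy' : a - y * b = 0 := hy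
  have hb : b ≠ 0 := by
    rintro rfl
    exact h ⟨by simpa using hx', rfl⟩
  exact Subtype.ext (mul_right_cancel₀ hb (by linear_combination hy' - hx'))

end Counting

/-! ### The secret of a sharing -/

section Secret

variable {G H : Type} [AddCommGroup G] [AddCommGroup H] (c : Option (Fin 3))

/-- The share that the corrupted party j would supply is read from party j + 1, which is honest. -/
theorem joined_honest (j : Fin 3) :
    (c = some j → c ≠ some (j + 1)) := by
  rintro rfl h
  revert h
  revert j
  decide

/-- `joined` consults honest parties only, so the meaningless entry of the corrupted party may be
changed at will. -/
theorem secret_congr {s s' : Fin 3 → Sh G} (h : ∀ i, c ≠ some i → s i = s' i) :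
    secret c s = secret c s' := by
  refine Finset.sum_congr rfl fun j _ => ?_
  unfold joined
  split_ifs with hc
  · rw [h _ (joined_honest c j hc)]
  · rw [h j hc]

theorem secret_add (s s' : Fin 3 → Sh G) :
    secret c (fun i => s i + s' i) = secret c s + secret c s' := by
  unfold secret
  rw [← Finset.sum_add_distrib]
  refine Finset.sum_congr rfl fun j _ => ?_
  unfold joined
  split_ifs <;> rfl

theorem secret_map (f : G →+ H) (s : Fin 3 → Sh G) :
    secret c (fun i => (s i).map f) = f (secret c s) := by
  unfold secret
  rw [map_sum]
  refine Finset.sum_congr rfl fun j _ => ?_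
  unfold joined
  split_ifs <;> rfl

theorem secret_pair (s : Fin 3 → Sh G) (s' : Fin 3 → Sh H) :
    secret c (fun i => (s i).pair (s' i)) = (secret c s, secret c s') := by
  unfold secret
  refine Prod.ext ?_ ?_
  · rw [Prod.fst_sum]
    refine Finset.sum_congr rfl fun j _ => ?_
    unfold joined
    split_ifs <;> rfl
  · rw [Prod.snd_sum]
    refine Finset.sum_congr rfl fun j _ => ?_
    unfold joined
    split_ifs <;> rfl

/-- Whatever two shares the corrupted party picks, the third one absorbs the difference; its choice
therefore has no influence on the values. -/
theorem secret_shareOut (x : G) (a : Sh G) : secret c (shareOut c x a) = x := by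
  unfold secret
  rw [Fin.sum_univ_three]
  have h1 : (-1 : Fin 3) = 2 := rfl
  have h2 : (0 : Fin 3) - 1 = 2 := rfl
  have h3 : (2 : Fin 3) - 1 = 1 := rfl
  have h4 : (2 : Fin 3) + 1 = 0 := rfl
  have h5 : (1 : Fin 3) + 1 = 2 := rfl
  have h6 : (1 : Fin 3) ≠ 2 := by decide
  rcases c with _ | c
  · simp [joined, shareOut, h1, h6]
    abel
  · fin_cases c <;> simp [joined, shareOut, h2, h3, h4, h5, h6, h6.symm] <;> abel

/-- The secret as a homomorphism. -/
def secretHom : (Fin 3 → Sh G) →+ G where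
  toFun := secret c
  map_zero' := by simp [secret, joined]
  map_add' := secret_add c

theorem secret_sum {ι : Type} (t : Finset ι) (s : ι → Fin 3 → Sh G) :
    secret c (fun i => ∑ j ∈ t, s j i) = ∑ j ∈ t, secret c (s j) := by
  refine Eq.trans ?_ (map_sum (secretHom (G := G) c) s t)
  show secret c _ = secret c _
  congr 1
  funext i
  simp

theorem secret_sub (s s' : Fin 3 → Sh G) :
    secret c (fun i => s i - s' i) = secret c s - secret c s' :=
  map_sub (secretHom c) s s'

theorem secret_smul {K : Type} [Field K] (a : K) (s : Fin 3 → Sh K) :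
    secret c (fun i => a • s i) = a * secret c s :=
  secret_map c (AddMonoidHom.mulLeft a) s

end Secret

/-! ### Processes in continuation-passing style -/

section Play

variable {K : Type} [Field K] {V R : Type*}

/-- All honest parties receive their answers. -/
def Delivered (c : Option (Fin 3)) (b : Fin 3 → Bool) : Prop := ∀ i, c ≠ some i → b i = true

variable {S : Setting K}

/-- The values of the secrets and of the public variables in the states of the parties. -/
@[ext] structure Vals (S : Setting K) : Type where
  inT : S.TreeArray
  inX : S.Features
  T : Fin S.m → K
  M : Fin S.m → K
  X : S.Features
  key : K
  r : K
  sr : K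
  v : K
  w : K
  vOpen : K
  node : K
  x : Word S.k
  b : ZMod 2
  idx : Word S.k
  picked : Fin S.dpad → K × K
  result : Word S.k

/-- The values in given states, where `vo` is the public opened value. -/
def valsOf (c : Option (Fin 3)) (st : Fin 3 → PState S) (vo : K) : Vals S where
  inT := if c = some S.mo then 0 else (st S.mo).inT
  inX := if c = some S.fo then 0 else (st S.fo).inX
  T j := secret c fun i => (st i).T j
  M j := secret c fun i => (st i).M j
  X := secret c fun i => (st i).X
  key := secret c fun i => (st i).key
  r := secret c fun i => (st i).r
  sr := secret c fun i => (st i).sr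
  v := secret c fun i => (st i).v
  w := secret c fun i => (st i).w
  vOpen := vo
  node := secret c fun i => (st i).node
  x := secret c fun i => (st i).x
  b := secret c fun i => (st i).b
  idx := secret c fun i => (st i).idx
  picked j := (secret c fun i => ((st i).picked j).1, secret c fun i => ((st i).picked j).2)
  result := secret c fun i => (st i).result

/-- `u` holds the values of the states `st`. -/
def Holds (c : Option (Fin 3)) (st : Fin 3 → PState S) (u : Vals S) : Prop :=
  (∀ i, c ≠ some i → (st i).vOpen = u.vOpen) ∧ u = valsOf c st u.vOpen

/-- Allows the entry of the corrupted party to be replaced by the default that `exec` uses for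
parties without a state. -/
theorem Holds.congr {c : Option (Fin 3)} {st st' : Fin 3 → PState S} {u : Vals S}
    (h : Holds c st u) (hst : ∀ i, c ≠ some i → st i = st' i) : Holds c st' u := by
  refine ⟨fun i hi => by rw [← hst i hi, h.1 i hi], ?_⟩
  rw [h.2]
  have sec {G : Type} [AddCommGroup G] (f : PState S → Sh G) :
      secret c (fun i => f (st i)) = secret c fun i => f (st' i) :=
    secret_congr c fun i hi => by rw [hst i hi]
  have h1 : (if c = some S.mo then 0 else (st S.mo).inT)
      = if c = some S.mo then 0 else (st' S.mo).inT := by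
    split_ifs with hc
    · rfl
    · rw [hst _ hc]
  have h2 : (if c = some S.fo then 0 else (st S.fo).inX)
      = if c = some S.fo then 0 else (st' S.fo).inX := by
    split_ifs with hc
    · rfl
    · rw [hst _ hc]
  exact Vals.ext h1 h2 (funext fun j => sec fun s => s.T j) (funext fun j => sec fun s => s.M j)
    (sec PState.X) (sec PState.key) (sec PState.r) (sec PState.sr) (sec PState.v) (sec PState.w)
    rfl (sec PState.node) (sec PState.x) (sec PState.b) (sec PState.idx)
    (funext fun j => Prod.ext (sec fun s => (s.picked j).1) (sec fun s => (s.picked j).2))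
    (sec PState.result)

/-- A protocol step together with its effect on the values: the functionality's coins, and the
leak and the new values (`none`: all honest parties abort) as functions of them. -/
structure AStep (S : Setting K) : Type 1 where
  step : Step K (PState S)
  Coins : Type
  coins : PMF Coins
  leak : Vals S → Coins → step.F.Leak
  next : Vals S → Coins → step.F.Reply → Option (Vals S)

/-- The description by values is correct. -/
def AStep.Sound (c : Option (Fin 3)) (a : AStep S) : Prop :=
  ∀ st u, Holds c st u → ∃ out : a.Coins → a.step.F.Reply → Fin 3 → a.step.F.Out,
    a.step.F.run c (fun i => a.step.inp i (st i)) = a.coins.map (fun o => (a.leak u o, out o)) ∧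
    ∀ o r, match a.next u o r with
      | none => ∀ i, c ≠ some i → a.step.upd i (st i) (out o r i) = none
      | some u' => ∃ st', (∀ i, c ≠ some i → a.step.upd i (st i) (out o r i) = some (st' i)) ∧
          Holds c st' u'

open Classical in
/-- Execution on values, continued by `cont`, or by `onAbort` when the honest parties abort. -/
def play (c : Option (Fin 3)) (A : Adversary K) (onAbort : List (Event K) → PMF R) :
    List (AStep S) → (List (Event K) → Vals S → PMF R) → List (Event K) → Vals S → PMF R
  | [], cont, h, u => cont h u
  | a :: rest, cont, h, u =>
    a.coins.bind fun o => (replyTo c A h a.step.F (a.leak u o)).bind fun x =>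
      if Delivered c x.2 then
        match a.next u o x.1 with
        | none => onAbort (h ++ [⟨a.step.F, a.leak u o, x⟩])
        | some u' => play c A onAbort rest cont (h ++ [⟨a.step.F, a.leak u o, x⟩]) u'
      else onAbort (h ++ [⟨a.step.F, a.leak u o, x⟩])

theorem play_append (c : Option (Fin 3)) (A : Adversary K) (onAbort : List (Event K) → PMF R)
    (l l' : List (AStep S)) (cont : List (Event K) → Vals S → PMF R) (h : List (Event K))
    (u : Vals S) :
    play c A onAbort (l ++ l') cont h u = play c A onAbort l (play c A onAbort l' cont) h u := by
  induction l generalizing h u with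
  | nil => rfl
  | cons a l ih =>
    rw [List.cons_append, play, play]
    simp only [ih]

theorem exec_of_not_honest {St : Type} [Inhabited St] {c : Option (Fin 3)} (A : Adversary K)
    (s : Step K St) (l : List (Step K St)) (h : List (Event K)) {σ : Fin 3 → Option St}
    (hσ : ¬∀ i, c ≠ some i → (σ i).isSome) :
    exec c A (s :: l) h σ = PMF.pure (h, fun _ => none) := by
  rw [exec, if_neg hσ]

/-- The execution of a protocol that ends with a nonempty list of steps is determined by the
values. -/
theorem exec_eq_play (c : Option (Fin 3)) (A : Adversary K) (l : List (AStep S))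
    (hl : ∀ a ∈ l, a.Sound c) (s : Step K (PState S)) (l' : List (Step K (PState S)))
    (φ : List (Event K) × (Fin 3 → Option (PState S)) → R)
    (cont : List (Event K) → Vals S → PMF R)
    (hcont : ∀ h σ st u, (∀ i, c ≠ some i → σ i = some (st i)) → Holds c st u →
      (exec c A (s :: l') h σ).map φ = cont h u)
    (h : List (Event K)) (σ : Fin 3 → Option (PState S)) (st : Fin 3 → PState S) (u : Vals S)
    (hσ : ∀ i, c ≠ some i → σ i = some (st i)) (hu : Holds c st u) :
    (exec c A (l.map AStep.step ++ s :: l') h σ).map φ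
      = play c A (fun h => PMF.pure (φ (h, fun _ => none))) l cont h u := by
  induction l generalizing h σ st u with
  | nil => exact hcont h σ st u hσ hu
  | cons a l ih =>
    have hσ' : ∀ i, c ≠ some i → (σ i).isSome := fun i hi => by rw [hσ i hi]; rfl
    have hst : ∀ i, c ≠ some i → st i = (σ i).getD default := fun i hi => by rw [hσ i hi]; rfl
    have hu' := hu.congr hst
    obtain ⟨out, hrun, hnext⟩ := hl a List.mem_cons_self _ u hu'
    -- An abort by one honest party spreads to the others only at the next call. The tail `s :: l'`
    -- guarantees that there is one, even after the last step of `l`.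
    have stuck (h : List (Event K)) (τ : Fin 3 → Option (PState S))
        (hτ : ∃ i, c ≠ some i ∧ τ i = none) :
        (exec c A (l.map AStep.step ++ s :: l') h τ).map φ
          = PMF.pure (φ (h, fun _ => none)) := by
      obtain ⟨i, hi, hi'⟩ := hτ
      have : ¬∀ i, c ≠ some i → (τ i).isSome := fun H => by
        have := H i hi
        rw [hi'] at this
        cases this
      cases l with
      | nil => rw [List.map_nil, List.nil_append, exec_of_not_honest A _ _ _ this, PMF.pure_map]
      | cons b l =>
        rw [List.map_cons, List.cons_append, exec_of_not_honest A _ _ _ this, PMF.pure_map]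
    rw [List.map_cons, List.cons_append, exec, if_pos hσ', hrun, PMF.bind_map, PMF.map_bind, play]
    congr 1
    funext o
    simp only [Function.comp_apply]
    rw [PMF.map_bind]
    congr 1
    funext x
    by_cases hx : Delivered c x.2
    · rw [if_pos hx]
      have H := hnext o x.1
      cases hn : a.next u o x.1 with
      | none =>
        rw [hn] at H
        obtain ⟨i, hi⟩ : ∃ i, c ≠ some i := by
          rcases c with _ | c
          · exact ⟨0, by simp⟩
          · exact ⟨c + 1, joined_honest _ c rfl⟩
        refine stuck _ _ ⟨i, hi, ?_⟩
        have h1 := H i hi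
        have h2 : σ i = some ((σ i).getD default) := by rw [← hst i hi, hσ i hi]
        rw [h2]
        simp only [if_pos (hx i hi), Option.bind_some, h1]
      | some u' =>
        rw [hn] at H
        obtain ⟨st', hst', hu''⟩ := H
        refine ih (fun b hb => hl b (List.mem_cons_of_mem _ hb)) _ _ st' u' (fun i hi => ?_) hu''
        have h2 : σ i = some ((σ i).getD default) := by rw [← hst i hi, hσ i hi]
        rw [h2]
        simp only [if_pos (hx i hi), Option.bind_some, hst' i hi]
    · rw [if_neg hx]
      have hx' : ∃ i, c ≠ some i ∧ ¬x.2 i = true := by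
        unfold Delivered at hx
        push Not at hx
        simpa using hx
      obtain ⟨i, hi, hi'⟩ := hx'
      exact stuck _ _ ⟨i, hi, by rw [if_neg hi']⟩

end Play

/-! ### The protocol in terms of values -/

section Values

variable {K : Type} [Field K] [Fintype K] [DecidableEq K] (S : Setting K) (c : Option (Fin 3))

/-- The MAC check on values. -/
def macValues (N : ℕ) (sh : PState S → Fin N → Sh K × Sh K) (get : Vals S → Fin N → K × K) :
    List (AStep S) :=
  [ { step :=
        { F := Frand K
          inp := fun _ _ => ()
          upd := fun _ s o => some { s with r := o } }
      Coins := K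
      coins := unif K
      leak := fun _ _ => ()
      next := fun u o _ => some { u with r := o } },
    { step :=
        { F := Fmul K 1
          inp := fun _ s _ => (s.r, s.key)
          upd := fun _ s o => some { s with sr := o 0 } }
      Coins := Unit
      coins := PMF.pure ()
      leak := fun _ _ => ()
      next := fun u _ y => some { u with sr := u.r * u.key + y.1 0 } },
    { step :=
        { F := Fcoin K N
          inp := fun _ _ => ()
          upd := fun _ s ρ => some { s with
            v := s.r + ∑ j, (ρ j : K) • (sh s j).1
            w := s.sr + ∑ j, (ρ j : K) • (sh s j).2 } }
      Coins := Fin N → Kˣ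
      coins := unif (Fin N → Kˣ)
      leak := fun _ ρ => ρ
      next := fun u ρ _ => some { u with
        v := u.r + ∑ j, (ρ j : K) * (get u j).1
        w := u.sr + ∑ j, (ρ j : K) * (get u j).2 } },
    { step :=
        { F := Fopen K
          inp := fun _ s => s.v
          upd := fun _ s o => some { s with vOpen := o } }
      Coins := Unit
      coins := PMF.pure ()
      leak := fun u _ => u.v
      next := fun u _ _ => some { u with vOpen := u.v } },
    { step :=
        { F := FcheckZero K
          inp := fun _ s => s.w - s.vOpen • s.key
          upd := fun _ s (ok : Bool) => if ok then some s else none }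
      Coins := Unit
      coins := PMF.pure ()
      leak := fun u _ => decide (u.w - u.vOpen * u.key = 0)
      next := fun u _ _ => if u.w - u.vOpen * u.key = 0 then some u else none } ]

/-- The first three steps of the setup phase on values. -/
def setupValues : List (AStep S) :=
  [ { step :=
        { F := Fshare K S.TreeArray S.mo
          inp := fun _ s => s.inT
          upd := fun _ s o => some { s with T := fun j => o.map fun a => a j } }
      Coins := Unit
      coins := PMF.pure ()
      leak := fun _ _ => ()
      next := fun u _ y => some { u with T := if c = some S.mo then y.1 else u.inT } },
    { step :=
        { F := Frand K
          inp := fun _ _ => ()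
          upd := fun _ s o => some { s with key := o } }
      Coins := K
      coins := unif K
      leak := fun _ _ => ()
      next := fun u o _ => some { u with key := o } },
    { step :=
        { F := Fmul K S.m
          inp := fun _ s j => (s.key, s.T j)
          upd := fun _ s o => some { s with M := o } }
      Coins := Unit
      coins := PMF.pure ()
      leak := fun _ _ => ()
      next := fun u _ y => some { u with M := fun j => u.key * u.T j + y.1 j } } ]

/-- The sharing of the features on values. -/
def featureValues : AStep S where
  step :=
    { F := Fshare K S.Features S.fo
      inp := fun _ s => s.inX
      upd := fun _ s o => some { s with X := o, node := s.T ⟨0, Nat.two_pow_pos _⟩ } }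
  Coins := Unit
  coins := PMF.pure ()
  leak := fun _ _ => ()
  next := fun u _ y => some { u with
    X := if c = some S.fo then y.1 else u.inX
    node := u.T ⟨0, Nat.two_pow_pos _⟩ }

/-- An iteration of the evaluation phase on values. -/
def iterationValues (j : Fin S.dpad) : List (AStep S) :=
  [ { step :=
        { F := F3pc K S.innerProd
          inp := fun _ s => s.X.pair (s.node.map S.sel)
          upd := fun _ s o => some { s with x := o } }
      Coins := Unit
      coins := PMF.pure ()
      leak := fun _ _ => ()
      next := fun u _ _ => some { u with x := S.innerProd (u.X, S.sel u.node) } },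
    { step :=
        { F := F3pc K S.less
          inp := fun _ s => s.x.pair (s.node.map S.thr)
          upd := fun _ s o => some { s with b := o } }
      Coins := Unit
      coins := PMF.pure ()
      leak := fun _ _ => ()
      next := fun u _ _ => some { u with b := S.less (u.x, S.thr u.node) } },
    { step :=
        { F := F3pc K S.mux
          inp := fun _ s => s.b.pair ((s.node.map S.left).pair (s.node.map S.right))
          upd := fun _ s o => some { s with idx := o } }
      Coins := Unit
      coins := PMF.pure ()
      leak := fun _ _ => ()
      next := fun u _ _ => some { u with idx := S.mux (u.b, S.left u.node, S.right u.node) } },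
    { step :=
        { F := Fos K (Word S.k) (K × K) S.m S.pos
          inp := fun _ s => (s.idx, fun i => (s.T i).pair (s.M i))
          upd := fun _ s o => some { s with
            node := o.map Prod.fst
            picked := Function.update s.picked j (o.map Prod.fst, o.map Prod.snd)
            result := o.map fun a => S.cls a.1 } }
      Coins := Unit
      coins := PMF.pure ()
      leak := fun _ _ => ()
      next := fun u _ y => some { u with
        node := u.T (S.pos u.idx) + y.1.1
        picked := Function.update u.picked j
          (u.T (S.pos u.idx) + y.1.1, u.M (S.pos u.idx) + y.1.2)
        result := S.cls (u.T (S.pos u.idx) + y.1.1) } } ]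

/-- The protocol without its last step, on values. -/
def protocolValues : List (AStep S) :=
  (setupValues S c ++ macValues S S.m (fun s j => (s.T j, s.M j)) fun u j => (u.T j, u.M j))
  ++ (featureValues S c :: ((List.finRange S.dpad).flatMap (iterationValues S)
  ++ macValues S S.dpad (fun s j => s.picked j) fun u j => u.picked j))

/-- The last step of the protocol. -/
def reconStep : Step K (PState S) where
  F := Frecon K (Word S.k) S.fo
  inp := fun _ s => s.result
  upd := fun _ s o => some { s with output := o }

/-- The reconstruction stays outside the description by values: no call follows it, so the adversary
can there withhold the answer from some honest parties without making the others abort. -/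
theorem protocol_eq :
    protocol S = (protocolValues S c).map AStep.step ++ [reconStep S] := by
  have h : ((List.finRange S.dpad).flatMap (iterationValues S)).map AStep.step
      = (List.finRange S.dpad).flatMap (iteration S) := by
    rw [List.map_flatMap]
    rfl
  unfold protocol evalSteps protocolValues
  simp only [List.map_append, List.map_cons, h]
  simp only [setupSteps, List.append_assoc, List.cons_append, List.nil_append]
  rfl

variable {S c}

/-- Since `S.bits` is additive, the fields of a node are additive maps, and share-wise projection of
a sharing projects its secret. -/
def selHom (S : Setting K) : K →+ (Fin S.n → ZMod 2) where
  toFun := S.sel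
  map_zero' := by funext i; simp [Setting.sel]
  map_add' x y := by funext i; simp [Setting.sel]

def thrHom (S : Setting K) : K →+ Word S.k where
  toFun := S.thr
  map_zero' := by funext i; simp [Setting.thr]
  map_add' x y := by funext i; simp [Setting.thr]

def leftHom (S : Setting K) : K →+ Word S.k where
  toFun := S.left
  map_zero' := by funext i; simp [Setting.left]
  map_add' x y := by funext i; simp [Setting.left]

def rightHom (S : Setting K) : K →+ Word S.k where
  toFun := S.right
  map_zero' := by funext i; simp [Setting.right]
  map_add' x y := by funext i; simp [Setting.right]

def clsHom (S : Setting K) : K →+ Word S.k where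
  toFun := S.cls
  map_zero' := by funext i; simp [Setting.cls]
  map_add' x y := by funext i; simp [Setting.cls]

/-- The local updates are linear in the shares once the public coefficients are fixed, so they
commute with `secret`. The hypothesis `hget` ties the pairs read from the values to those read from
the states. -/
theorem macValues_sound (N : ℕ) (sh : PState S → Fin N → Sh K × Sh K)
    (get : Vals S → Fin N → K × K)
    (hget : ∀ st vo j, get (valsOf c st vo) j
      = (secret c fun i => (sh (st i) j).1, secret c fun i => (sh (st i) j).2)) :
    ∀ a ∈ macValues S N sh get, a.Sound c := by
  unfold macValues
  simp only [List.forall_mem_cons, List.not_mem_nil, false_imp_iff, implies_true, and_true]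
  refine ⟨?_, ?_, ?_, ?_, ?_⟩
  · rintro st u ⟨hv, hu⟩
    refine ⟨fun (x : K) (a : Sh K) => shareOut c x a, rfl, fun (x : K) (a : Sh K) => ⟨fun i => { st i with r := shareOut c x a i },
      fun _ _ => rfl, hv, ?_⟩⟩
    dsimp only
    rw [hu]
    simp only [valsOf, secret_shareOut]
  · rintro st u ⟨hv, hu⟩
    refine ⟨fun _ r i j => shareOut c (u.r * u.key + r.1 j) (r.2 j) i, ?_,
      fun _ (r : (Fin 1 → K) × (Fin 1 → Sh K)) =>
      ⟨fun i => { st i with sr := shareOut c (u.r * u.key + r.1 0) (r.2 0) i },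
      fun _ _ => rfl, hv, ?_⟩⟩
    · rw [PMF.pure_map, hu]
      rfl
    · dsimp only
      rw [hu]
      simp only [valsOf, secret_shareOut]
  · rintro st u ⟨hv, hu⟩
    refine ⟨fun ρ _ _ => ρ, rfl, fun ρ _ => ⟨fun i => { st i with
        v := (st i).r + ∑ j, (ρ j : K) • (sh (st i) j).1
        w := (st i).sr + ∑ j, (ρ j : K) • (sh (st i) j).2 },
      fun _ _ => rfl, hv, ?_⟩⟩
    dsimp only
    rw [hu]
    simp only [hget]
    simp only [valsOf, secret_add, secret_sum, secret_smul]
  · rintro st u ⟨hv, hu⟩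
    refine ⟨fun _ _ _ => u.v, ?_, fun _ _ => ⟨fun i => { st i with vOpen := u.v },
      fun _ _ => rfl, fun _ _ => rfl, ?_⟩⟩
    · rw [PMF.pure_map, hu]
      rfl
    · dsimp only
      rw [hu]
      rfl
  · rintro st u ⟨hv, hu⟩
    refine ⟨fun _ _ _ => decide (u.w - u.vOpen * u.key = 0), ?_, fun _ _ => ?_⟩
    · rw [PMF.pure_map]
      -- All honest parties hold the same opened value, so it can be treated as a fixed scalar,
      -- which makes the combination linear.
      have : secret c (fun i => (st i).w - (st i).vOpen • (st i).key)
          = u.w - u.vOpen * u.key := by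
        rw [secret_congr c (s' := fun i => (st i).w - u.vOpen • (st i).key)
          fun i hi => by rw [hv i hi], secret_sub, secret_smul]
        rw [hu]
        rfl
      simp only [FcheckZero, this]
    · dsimp only
      by_cases h : u.w - u.vOpen * u.key = 0
      · rw [if_pos h]
        exact ⟨st, fun _ _ => by simp [h], hv, hu⟩
      · rw [if_neg h]
        exact fun _ _ => by simp [h]

theorem setupValues_sound : ∀ a ∈ setupValues S c, a.Sound c := by
  unfold setupValues
  simp only [List.forall_mem_cons, List.not_mem_nil, false_imp_iff, implies_true, and_true]
  refine ⟨?_, ?_, ?_⟩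
  · rintro st u ⟨hv, hu⟩
    refine ⟨fun _ r => shareOut c (if c = some S.mo then r.1 else u.inT) r.2, ?_,
      fun _ (r : S.TreeArray × Sh S.TreeArray) => ⟨fun i => { st i with
        T := fun j => (shareOut c (if c = some S.mo then r.1 else u.inT) r.2 i).map fun a => a j },
      fun _ _ => rfl, hv, ?_⟩⟩
    · rw [PMF.pure_map, hu]
      unfold Fshare valsOf
      dsimp only
      congr 3
      funext r
      split_ifs <;> rfl
    · dsimp only
      have (x : S.TreeArray) (a : Sh S.TreeArray) (j : Fin S.m) :
          secret c (fun i => (shareOut c x a i).map fun a : S.TreeArray => a j) = x j :=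
        (secret_map c (Pi.evalAddMonoidHom (fun _ : Fin S.m => K) j) _).trans (by rw [secret_shareOut]; rfl)
      rw [hu]
      simp only [valsOf, this]
  · rintro st u ⟨hv, hu⟩
    refine ⟨fun (x : K) (a : Sh K) => shareOut c x a, rfl, fun (x : K) (a : Sh K) =>
      ⟨fun i => { st i with key := shareOut c x a i }, fun _ _ => rfl, hv, ?_⟩⟩
    dsimp only
    rw [hu]
    simp only [valsOf, secret_shareOut]
  · rintro st u ⟨hv, hu⟩
    refine ⟨fun _ r i j => shareOut c (u.key * u.T j + r.1 j) (r.2 j) i, ?_,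
      fun _ (r : (Fin S.m → K) × (Fin S.m → Sh K)) =>
      ⟨fun i => { st i with M := fun j => shareOut c (u.key * u.T j + r.1 j) (r.2 j) i },
      fun _ _ => rfl, hv, ?_⟩⟩
    · rw [PMF.pure_map, hu]
      rfl
    · dsimp only
      rw [hu]
      simp only [valsOf, secret_shareOut]

theorem featureValues_sound : (featureValues S c).Sound c := by
  rintro st u ⟨hv, hu⟩
  refine ⟨fun _ r => shareOut c (if c = some S.fo then r.1 else u.inX) r.2, ?_,
    fun _ (r : S.Features × Sh S.Features) => ⟨fun i => { st i with
      X := shareOut c (if c = some S.fo then r.1 else u.inX) r.2 i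
      node := (st i).T ⟨0, Nat.two_pow_pos _⟩ },
    fun _ _ => rfl, hv, ?_⟩⟩
  · unfold featureValues
    dsimp only
    rw [PMF.pure_map, hu]
    unfold Fshare valsOf
    dsimp only
    congr 3
    funext r
    split_ifs <;> rfl
  · dsimp only [featureValues]
    rw [hu]
    simp only [valsOf, secret_shareOut]

theorem iterationValues_sound (j : Fin S.dpad) : ∀ a ∈ iterationValues S j, a.Sound c := by
  unfold iterationValues
  simp only [List.forall_mem_cons, List.not_mem_nil, false_imp_iff, implies_true, and_true]
  have sel (s : Fin 3 → Sh K) : secret c (fun i => (s i).map S.sel) = S.sel (secret c s) :=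
    secret_map c (selHom S) s
  have thr (s : Fin 3 → Sh K) : secret c (fun i => (s i).map S.thr) = S.thr (secret c s) :=
    secret_map c (thrHom S) s
  have left (s : Fin 3 → Sh K) : secret c (fun i => (s i).map S.left) = S.left (secret c s) :=
    secret_map c (leftHom S) s
  have right (s : Fin 3 → Sh K) : secret c (fun i => (s i).map S.right) = S.right (secret c s) :=
    secret_map c (rightHom S) s
  refine ⟨?_, ?_, ?_, ?_⟩
  · rintro st u ⟨hv, hu⟩
    refine ⟨fun _ a => shareOut c (S.innerProd (u.X, S.sel u.node)) a, ?_, fun _ (a : Sh (Word S.k)) =>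
      ⟨fun i => { st i with x := shareOut c (S.innerProd (u.X, S.sel u.node)) a i },
        fun _ _ => rfl, hv, ?_⟩⟩
    · simp only [PMF.pure_map, F3pc, secret_pair, sel]
      rw [hu]
      rfl
    · dsimp only
      rw [hu]
      simp only [valsOf, secret_shareOut]
  · rintro st u ⟨hv, hu⟩
    refine ⟨fun _ a => shareOut c (S.less (u.x, S.thr u.node)) a, ?_, fun _ (a : Sh (ZMod 2)) =>
      ⟨fun i => { st i with b := shareOut c (S.less (u.x, S.thr u.node)) a i },
        fun _ _ => rfl, hv, ?_⟩⟩
    · simp only [PMF.pure_map, F3pc, secret_pair, thr]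
      rw [hu]
      rfl
    · dsimp only
      rw [hu]
      simp only [valsOf, secret_shareOut]
  · rintro st u ⟨hv, hu⟩
    refine ⟨fun _ a => shareOut c (S.mux (u.b, S.left u.node, S.right u.node)) a, ?_, fun _ (a : Sh (Word S.k)) =>
      ⟨fun i => { st i with
        idx := shareOut c (S.mux (u.b, S.left u.node, S.right u.node)) a i },
        fun _ _ => rfl, hv, ?_⟩⟩
    · simp only [PMF.pure_map, F3pc, secret_pair, left, right]
      rw [hu]
      rfl
    · dsimp only
      rw [hu]
      simp only [valsOf, secret_shareOut]
  · rintro st u ⟨hv, hu⟩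
    let y (e : K × K) : K × K := (u.T (S.pos u.idx), u.M (S.pos u.idx)) + e
    refine ⟨fun _ r => shareOut c (y r.1) r.2, ?_, fun _ (r : (K × K) × Sh (K × K)) =>
      ⟨fun i => { st i with
        node := (shareOut c (y r.1) r.2 i).map Prod.fst
        picked := Function.update (st i).picked j
          ((shareOut c (y r.1) r.2 i).map Prod.fst, (shareOut c (y r.1) r.2 i).map Prod.snd)
        result := (shareOut c (y r.1) r.2 i).map fun a => S.cls a.1 },
        fun _ _ => rfl, hv, ?_⟩⟩
    · simp only [PMF.pure_map, Fos, secret_pair, y]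
      rw [hu]
      rfl
    · dsimp only
      have h1 (r : (K × K) × Sh (K × K)) :
          secret c (fun i => (shareOut c (y r.1) r.2 i).map Prod.fst) = (y r.1).1 :=
        (secret_map c (AddMonoidHom.fst K K) _).trans (by rw [secret_shareOut]; rfl)
      have h2 (r : (K × K) × Sh (K × K)) :
          secret c (fun i => (shareOut c (y r.1) r.2 i).map Prod.snd) = (y r.1).2 :=
        (secret_map c (AddMonoidHom.snd K K) _).trans (by rw [secret_shareOut]; rfl)
      have h3 (r : (K × K) × Sh (K × K)) :
          secret c (fun i => (shareOut c (y r.1) r.2 i).map fun a => S.cls a.1)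
            = S.cls (y r.1).1 :=
        (secret_map c ((clsHom S).comp (AddMonoidHom.fst K K)) _).trans
          (by rw [secret_shareOut]; rfl)
      have hp : Function.update u.picked j
          (u.T (S.pos u.idx) + r.1.1, u.M (S.pos u.idx) + r.1.2) = fun l =>
          (secret c fun i => (Function.update (st i).picked j
            ((shareOut c (y r.1) r.2 i).map Prod.fst,
              (shareOut c (y r.1) r.2 i).map Prod.snd) l).1,
           secret c fun i => (Function.update (st i).picked j
            ((shareOut c (y r.1) r.2 i).map Prod.fst,
              (shareOut c (y r.1) r.2 i).map Prod.snd) l).2) := by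
        funext l
        by_cases hl : l = j
        · subst hl
          simp only [Function.update_self, h1, h2]
          rfl
        · simp only [Function.update_of_ne hl]
          rw [hu]
          rfl
      refine Vals.ext ?_ ?_ ?_ ?_ ?_ ?_ ?_ ?_ ?_ ?_ ?_ ?_ ?_ ?_ ?_ ?_ ?_
      all_goals first
        | exact hp
        | exact (h1 r).symm
        | exact (h3 r).symm
        | (dsimp only; rw [hu]; rfl)

theorem protocolValues_sound : ∀ a ∈ protocolValues S c, a.Sound c := by
  intro a ha
  simp only [protocolValues, List.mem_append, List.mem_cons, List.mem_flatMap] at ha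
  rcases ha with (ha | ha) | ha | ⟨j, -, ha⟩ | ha
  · exact setupValues_sound a ha
  · exact macValues_sound _ _ _ (fun _ _ _ => rfl) a ha
  · exact ha ▸ featureValues_sound
  · exact iterationValues_sound j a ha
  · exact macValues_sound _ _ _ (fun _ _ _ => rfl) a ha

end Values

/-! ### The hybrid process -/

section Hybrid

variable {K : Type} [Field K] {R : Type*}

/-- No call in the history was tampered with. -/
def Clean (h : List (Event K)) : Prop := ∀ e ∈ h, ¬e.F.tampers e.reply.1

theorem clean_append {h h' : List (Event K)} : Clean (h ++ h') ↔ Clean h ∧ Clean h' := by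
  simp only [Clean, List.mem_append, or_imp, forall_and]

theorem clean_singleton {e : Event K} : Clean [e] ↔ ¬e.F.tampers e.reply.1 := by
  simp [Clean]

/-- A call in which the leak depends on the history only. If `check` is set, then honest parties
go on only if there was no tampering. -/
structure HStep (K : Type) [Field K] : Type 1 where
  F : Functionality K
  leak : List (Event K) → F.Leak
  check : Bool

open Classical in
/-- The conversation of the adversary with the steps `l`. -/
def hplay (p : Fin 3) (A : Adversary K) (onAbort : List (Event K) → PMF R) :
    List (HStep K) → (List (Event K) → PMF R) → List (Event K) → PMF R
  | [], cont, h => cont h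
  | s :: rest, cont, h =>
    (A h s.F (s.leak h)).bind fun x =>
      if Delivered (some p) x.2 ∧ (s.check = true → Clean h) then
        hplay p A onAbort rest cont (h ++ [⟨s.F, s.leak h, x⟩])
      else onAbort (h ++ [⟨s.F, s.leak h, x⟩])

theorem hplay_append (p : Fin 3) (A : Adversary K) (onAbort : List (Event K) → PMF R)
    (l l' : List (HStep K)) (cont : List (Event K) → PMF R) (h : List (Event K)) :
    hplay p A onAbort (l ++ l') cont h = hplay p A onAbort l (hplay p A onAbort l' cont) h := by
  induction l generalizing h with
  | nil => rfl
  | cons a l ih =>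
    rw [List.cons_append, hplay, hplay]
    simp only [ih]

/-- An average over the continuation can be moved to the front. -/
theorem hplay_bind {Ω : Type*} (p : Fin 3) (A : Adversary K) (onAbort : List (Event K) → PMF R)
    (l : List (HStep K)) (q : PMF Ω) (cont : Ω → List (Event K) → PMF R) (h : List (Event K)) :
    (q.bind fun t => hplay p A onAbort l (cont t) h)
      = hplay p A onAbort l (fun h => q.bind fun t => cont t h) h := by
  induction l generalizing h with
  | nil => rfl
  | cons a l ih =>
    simp only [hplay]
    rw [PMF.bind_comm]
    congr 1
    funext x
    split_ifs
    · rw [ih]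
    · rw [PMF.bind_const]

/-- The reply and the decision to go on do not involve the hidden samples, so the reply can be drawn
first. The hidden averages then act on the continuation alone, and disappear on the aborting branch.
-/
theorem within_step {Ω₁ Ω₂ Ω₃ : Type*} {ε : ℝ≥0∞} {p : PMF Ω₁} {q : PMF Ω₂} {s : PMF Ω₃}
    {P Q : Ω₃ → Prop} [DecidablePred P] [DecidablePred Q]
    {f : Ω₁ → Ω₃ → PMF R} {f' : Ω₂ → Ω₃ → PMF R} {g g' : Ω₃ → PMF R}
    (hPQ : ∀ a, P a ↔ Q a) (hg : g = g')
    (h : ∀ a, P a → Within ε (p.bind fun x => f x a) (q.bind fun y => f' y a)) :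
    Within ε (p.bind fun x => s.bind fun a => if P a then f x a else g a)
      (q.bind fun y => s.bind fun a => if Q a then f' y a else g' a) := by
  subst hg
  rw [PMF.bind_comm, PMF.bind_comm q]
  refine within_bind s fun a => ?_
  by_cases ha : P a
  · simp only [if_pos ha, if_pos ((hPQ a).1 ha)]
    exact h a ha
  · simp only [if_neg ha, if_neg fun h => ha ((hPQ a).2 h), PMF.bind_const]
    exact (Within.refl _).mono zero_le

theorem within_step_left {Ω₁ Ω₃ : Type*} {ε : ℝ≥0∞} {p : PMF Ω₁} {s : PMF Ω₃}
    {P Q : Ω₃ → Prop} [DecidablePred P] [DecidablePred Q]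
    {f : Ω₁ → Ω₃ → PMF R} {f' : Ω₃ → PMF R} {g g' : Ω₃ → PMF R}
    (hPQ : ∀ a, P a ↔ Q a) (hg : g = g')
    (h : ∀ a, P a → Within ε (p.bind fun x => f x a) (f' a)) :
    Within ε (p.bind fun x => s.bind fun a => if P a then f x a else g a)
      (s.bind fun a => if Q a then f' a else g' a) := by
  have := within_step (ε := ε) (p := p) (q := PMF.pure ()) (s := s) (f := f)
    (f' := fun _ : Unit => f') hPQ hg fun a ha => by simpa only [PMF.pure_bind] using h a ha
  simpa only [PMF.pure_bind] using this

theorem within_step_same {Ω₃ : Type*} {ε : ℝ≥0∞} {s : PMF Ω₃} {P Q : Ω₃ → Prop}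
    [DecidablePred P] [DecidablePred Q] {f f' g g' : Ω₃ → PMF R}
    (hPQ : ∀ a, P a ↔ Q a) (hg : g = g') (h : ∀ a, P a → Within ε (f a) (f' a)) :
    Within ε (s.bind fun a => if P a then f a else g a)
      (s.bind fun a => if Q a then f' a else g' a) := by
  have := within_step_left (ε := ε) (p := PMF.pure ()) (s := s) (f := fun _ : Unit => f)
    (f' := f') hPQ hg fun a ha => by simpa only [PMF.pure_bind] using h a ha
  simpa only [PMF.pure_bind] using this

theorem within_prod {α β : Type} [Fintype α] [Nonempty α] [Fintype β] [Nonempty β] {ε : ℝ≥0∞}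
    {f : α → β → PMF R} {q : PMF R}
    (h : Within ε ((unif (α × β)).bind fun t => f t.1 t.2) q) :
    Within ε ((unif α).bind fun a => (unif β).bind fun b => f a b) q := by
  rwa [unif_prod_bind] at h

theorem within_bind_left_of_bad {Ω₁ : Type*} {ε δ : ℝ≥0∞} {p : PMF Ω₁} {f : Ω₁ → PMF R}
    {q : PMF R} (B : Set Ω₁) (h : ∀ x, x ∉ B → Within ε (f x) q) (hB : p.toOuterMeasure B ≤ δ) :
    Within (ε + δ) (p.bind f) q := by
  have := within_bind_of_bad p (g := fun _ => q) B h hB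
  rwa [PMF.bind_const] at this

theorem within_prod_right {α β : Type} [Fintype α] [Nonempty α] [Fintype β] [Nonempty β]
    {ε : ℝ≥0∞} {f : α × β → PMF R} {q : PMF R}
    (h : Within ε q ((unif α).bind fun a => (unif β).bind fun b => f (a, b))) :
    Within ε q ((unif (α × β)).bind f) := by
  rwa [unif_prod_bind]

/-- Substituting r = v − c(a) trades the uniform mask for the opened value, which is uniform for
each a. -/
theorem within_shift {α G : Type} [AddGroup G] [Fintype G] {ε : ℝ≥0∞} {p : PMF α}
    {f : α → G → PMF R} {q : PMF R} (c : α → G)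
    (h : Within ε (p.bind fun a => (unif G).bind fun v => f a (v - c a)) q) :
    Within ε (p.bind fun a => (unif G).bind fun r => f a r) q := by
  have (a : α) : ((unif G).bind fun v => f a (v - c a)) = (unif G).bind fun r => f a r := by
    simpa only [sub_eq_add_neg] using unif_shift (-(c a)) (f a)
  simpa only [this] using h

theorem within_bind_comm_of_bad {Ω₁ Ω₂ : Type*} {ε δ : ℝ≥0∞} {p : PMF Ω₁} {s : PMF Ω₂}
    {f : Ω₁ → Ω₂ → PMF R} {g : Ω₂ → PMF R} (B : Set Ω₂)
    (h : ∀ b, b ∉ B → Within ε (p.bind fun x => f x b) (g b)) (hB : s.toOuterMeasure B ≤ δ) :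
    Within (ε + δ) (p.bind fun x => s.bind fun b => f x b) (s.bind g) := by
  rw [PMF.bind_comm]
  exact within_bind_of_bad s B h hB

variable [Fintype K] [DecidableEq K] {S : Setting K}

open Classical in
/-- The MAC check in the hybrid process, with public coefficients `ρ` and opened value `v`. -/
def macHybrid (N : ℕ) (ρ : Fin N → Kˣ) (v : K) : List (HStep K) :=
  [ { F := Frand K, leak := fun _ => (), check := false },
    { F := Fmul K 1, leak := fun _ => (), check := false },
    { F := Fcoin K N, leak := fun _ => ρ, check := false },
    { F := Fopen K, leak := fun _ => v, check := false },
    { F := FcheckZero K, leak := fun h => decide (Clean h), check := true } ]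

set_option maxHeartbeats 2000000 in
-- The states form a family indexed by the key, so that α stays averaged instead of fixed. The
-- continuations need only be close on average over α, and only for clean histories: there the
-- verdict and `v` carry no information on α, while tampered runs end at the check. The two error
-- terms account for α being a root and for the coefficients killing the affine form.
theorem mac_within (p : Fin 3) (A : Adversary K) (onAbort : List (Event K) → PMF R) {N : ℕ}
    {sh : PState S → Fin N → Sh K × Sh K} {get : Vals S → Fin N → K × K}
    (hget : ∀ u r sr v w vo, get { u with r := r, sr := sr, v := v, w := w, vOpen := vo } = get u)
    {h : List (Event K)} {u : K → Vals S} {δ ε : Fin N → K} (hkey : ∀ α, (u α).key = α)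
    (hdef : ∀ α j, (get (u α) j).2 = α * (get (u α) j).1 + (ε j - α * δ j))
    (hclean : Clean h ↔ δ = 0 ∧ ε = 0)
    {cont : List (Event K) → Vals S → PMF R} {cont' : List (Event K) → PMF R} {η : ℝ≥0∞}
    (hcont : ∀ h', h <+: h' → h'.length = h.length + 5 → Clean h' → ∀ r sr v w vo : K → K,
      Within η ((unif K).bind fun α => cont h' { u α with
        r := r α, sr := sr α, v := v α, w := w α, vOpen := vo α }) (cont' h')) :
    Within (η + ((1 : ℕ) / (Fintype.card K : ℕ) + (2 : ℕ) / (Fintype.card K : ℕ)))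
      ((unif K).bind fun α => play (some p) A onAbort (macValues S N sh get) cont h (u α))
      ((unif ((Fin N → Kˣ) × K)).bind fun t =>
        hplay p A onAbort (macHybrid N t.1 t.2) cont' h) := by
  classical
  -- The mask and the values cancel; what remains is an affine form in α made of the errors alone.
  have hz (α r e : K) (ρ : Fin N → Kˣ) :
      r * (u α).key + e + ∑ j, (ρ j : K) * (get (u α) j).2
        - (r + ∑ j, (ρ j : K) * (get (u α) j).1) * (u α).key
        = e + ∑ j, (ρ j : K) * ε j - α * ∑ j, (ρ j : K) * δ j := by
    simp only [hdef, hkey, mul_add, mul_sub, Finset.sum_add_distrib, Finset.sum_sub_distrib,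
      add_mul, Finset.sum_mul, Finset.mul_sum]
    have h1 : ∑ j, (ρ j : K) * (α * (get (u α) j).1) = ∑ j, (ρ j : K) * (get (u α) j).1 * α :=
      Finset.sum_congr rfl fun j _ => by ring
    have h2 : ∑ j, (ρ j : K) * (α * δ j) = ∑ j, α * ((ρ j : K) * δ j) :=
      Finset.sum_congr rfl fun j _ => by ring
    rw [h1, h2]
    ring
  simp only [macValues, play, macHybrid, hplay, PMF.pure_bind, replyTo, hget, hz]
  refine within_prod (within_step (fun a => by simp) rfl fun x₁ _ => ?_)
  refine within_step (fun a => by simp) rfl fun x₂ _ => ?_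
  set e : K := x₂.1.1 0 with he
  rw [← add_assoc]
  refine within_prod_right ?_
  dsimp only
  -- Bad coefficients: some error is present, yet the affine form in α vanishes identically.
  refine within_bind_comm_of_bad {ρ : Fin N → Kˣ | ¬(δ = 0 ∧ ε = 0 ∧ e = 0) ∧
    e + ∑ j, (ρ j : K) * ε j = 0 ∧ ∑ j, (ρ j : K) * δ j = 0} (fun ρ hρ => ?_) ?_
  swap
  · by_cases hδ : δ = 0
    · by_cases hε : ε = 0
      -- Here e is the only possible error, and the first equation reduces to e = 0; so no
      -- coefficients are bad.
      · refine le_trans (le_of_eq ?_) zero_le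
        rw [show {ρ : Fin N → Kˣ | _} = ∅ from ?_, MeasureTheory.measure_empty]
        ext ρ
        simp [hδ, hε]
      · refine le_trans (MeasureTheory.measure_mono ?_) (unif_linear_le e ε hε)
        exact fun ρ hρ => hρ.2.1
    · refine le_trans (MeasureTheory.measure_mono ?_) (unif_linear_le 0 δ hδ)
      exact fun ρ hρ => by simpa using hρ.2.2
  refine within_step (fun a => by simp) rfl fun x₃ _ => ?_
  rw [unif_prod_bind]
  dsimp only
  -- The mask makes the opened value uniform and independent of α, so that both processes can draw
  -- the same `v`.
  refine within_shift (fun α => ∑ j, (ρ j : K) * (get (u α) j).1) ?_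
  simp only [sub_add_cancel]
  refine within_bind_comm _ _ fun v => ?_
  refine within_step_left (fun a => by simp) rfl fun x₄ _ => ?_
  set h₄ := h ++ [⟨Frand K, (), x₁⟩] ++ [⟨Fmul K 1, (), x₂⟩] ++ [⟨Fcoin K N, ρ, x₃⟩]
    ++ [⟨Fopen K, v, x₄⟩] with hh₄
  have hc₄ : Clean h₄ ↔ δ = 0 ∧ ε = 0 ∧ e = 0 := by
    rw [hh₄]
    simp only [clean_append, clean_singleton, hclean, he]
    simp only [Frand, Fmul, Fcoin, Fopen, not_false_eq_true, and_true, not_not, and_assoc]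
    refine and_congr_right fun _ => and_congr_right fun _ => ?_
    exact ⟨fun H => congrFun H 0, fun H => funext fun i => by rw [Subsingleton.elim i 0]; exact H⟩
  by_cases hc : Clean h₄
  · obtain ⟨hδ, hε, he0⟩ := hc₄.1 hc
    simp only [hδ, hε, he0, Pi.zero_apply, mul_zero, Finset.sum_const_zero, add_zero, sub_zero,
      if_true, decide_true, hc]
    refine (within_step_left (fun a => by simp) rfl fun x₅ _ => ?_).mono le_self_add
    refine hcont _ ?_ ?_ ?_ (fun α => v - ∑ j, (ρ j : K) * (get (u α) j).1) _ _ _ _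
    · simp only [hh₄, List.append_assoc]
      exact List.prefix_append _ _
    · simp [hh₄]
    · exact clean_append.2 ⟨hc, clean_singleton.2 id⟩
  -- With tampering the hybrid process answers false and aborts. The execution does the same unless
  -- α is the root of a nonzero affine form.
  · refine within_bind_left_of_bad {α : K | e + ∑ j, (ρ j : K) * ε j
      - α * ∑ j, (ρ j : K) * δ j = 0} (fun α hα => ?_) (unif_affine_le _ _ fun H => hρ ⟨?_, H⟩)
    · simp only [Set.mem_ofPred_eq] at hα
      refine Within.of_eq ?_ _
      simp [hα, hc]
    · exact fun H => hc (hc₄.2 H)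

end Hybrid

/-! ### Reading inputs off the history -/

section Extraction

variable {K : Type} [Field K] [DecidableEq K] (S : Setting K)

theorem eval_msg {E : Env K} {t : ℕ} {F : Functionality K} {y : F.Leak}
    {a : F.Reply × (Fin 3 → Bool)} (h : E.hist[t]? = some ⟨F, y, a⟩) (j : ℕ) :
    (Expr.msg t j).eval E = (haveI := F.codeReply; Code.enc a j) := by
  rw [Expr.eval, h]
  rfl

theorem evalList_map_range (E : Env K) (N : ℕ) (f : ℕ → Expr K) (j : ℕ) :
    evalList E ((List.range N).map f) j = if j < N then (f j).eval E else 0 := by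
  unfold evalList
  by_cases hj : j < N
  · simp [hj]
  · simp [hj]

/-- The formulas for the input that the corrupted party `p` gave to the sharing functionality. -/
def inputExprs (p : Fin 3) : List (Expr K) :=
  if p = S.mo then (List.range S.m).map fun j => .msg 0 (4 * j)
  else if p = S.fo then (List.range (S.n * S.k)).map fun j => .msg 8 (4 * j)
  else []

/-- The tree array in use, by the history. -/
def treeOf (p : Fin 3) (T : S.TreeArray) (h : List (Event K)) : S.TreeArray :=
  if p = S.mo then Code.dec (evalList ⟨0, 0, h, 0⟩ (inputExprs S p)) else T

/-- The feature vector in use, by the history. -/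
def featuresOf (p : Fin 3) (X : S.Features) (h : List (Event K)) : S.Features :=
  if p = S.fo then Code.dec (evalList ⟨0, 0, h, 0⟩ (inputExprs S p)) else X

theorem enc_pair_even {α β : Type} [Code K α] [Code K β] (a : α × β) (j : ℕ) :
    Code.enc (K := K) a (2 * j) = Code.enc a.1 j := by
  show (if 2 * j % 2 = 0 then _ else _) = _
  rw [if_pos (by omega), show 2 * j / 2 = j by omega]

theorem enc_pair_odd {α β : Type} [Code K α] [Code K β] (a : α × β) (j : ℕ) :
    Code.enc (K := K) a (2 * j + 1) = Code.enc a.2 j := by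
  show (if (2 * j + 1) % 2 = 0 then _ else _) = _
  rw [if_neg (by omega), show (2 * j + 1) / 2 = j by omega]

/-- A reply with its delivery flags has the shape ((input or error, shares), flags). Interleaving
twice puts the first component at the multiples of 4. -/
theorem enc_pair_four {α β γ : Type} [Code K α] [Code K β] [Code K γ] (a : (α × β) × γ) (j : ℕ) :
    Code.enc (K := K) a (4 * j) = Code.enc a.1.1 j := by
  rw [show 4 * j = 2 * (2 * j) by omega, enc_pair_even, enc_pair_even]

theorem enc_tuple {α : Type} [Code K α] {N : ℕ} (v : Fin N → α) (j : ℕ) :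
    Code.enc (K := K) v j
      = if h : 0 < N then Code.enc (v ⟨j % N, Nat.mod_lt _ h⟩) (j / N) else 0 := rfl

/-- Encodings have finite support with a known bound, so finitely many formulas reproduce a whole
encoded string. -/
theorem enc_tuple_eq_zero {α : Type} [Code K α] {N B : ℕ}
    (hB : ∀ (a : α) (j : ℕ), B ≤ j → Code.enc (K := K) a j = 0) (v : Fin N → α) {j : ℕ}
    (hj : N * B ≤ j) : Code.enc (K := K) v j = 0 := by
  rw [enc_tuple]
  split_ifs with h
  · exact hB _ _ ((Nat.le_div_iff_mul_le h).2 (by rwa [mul_comm] at hj))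
  · rfl

theorem enc_field_eq_zero (a : K) (j : ℕ) (hj : 1 ≤ j) : @Code.enc K ‹Field K› K _ a j = 0 :=
  if_neg (by omega)

theorem enc_bit_eq_zero (a : ZMod 2) (j : ℕ) (hj : 1 ≤ j) :
    @Code.enc K ‹Field K› (ZMod 2) _ a j = 0 :=
  if_neg (by omega)

theorem enc_word_eq_zero {k : ℕ} (a : Word k) (j : ℕ) (hj : k ≤ j) :
    @Code.enc K ‹Field K› (Word k) _ a j = 0 :=
  enc_tuple_eq_zero (B := 1) enc_bit_eq_zero a (by omega)

theorem treeOf_eq (p : Fin 3) (T : S.TreeArray) {h : List (Event K)} [Fintype K]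
    {a : (Fshare K S.TreeArray S.mo).Reply × (Fin 3 → Bool)}
    (hh : h[0]? = some ⟨Fshare K S.TreeArray S.mo, (), a⟩) :
    treeOf S p T h = if p = S.mo then a.1.1 else T := by
  unfold treeOf
  split_ifs with hp
  · have : evalList ⟨0, 0, h, 0⟩ (inputExprs S p) = Code.enc (K := K) (α := S.TreeArray) a.1.1 := by
      funext j
      rw [inputExprs, if_pos hp, evalList_map_range]
      split_ifs with hj
      · rw [eval_msg hh]
        exact enc_pair_four (α := S.TreeArray) (β := Sh S.TreeArray) a j
      · exact (enc_tuple_eq_zero (B := 1) enc_field_eq_zero _ (by omega)).symm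
    rw [this, Code.dec_enc]
  · rfl

/-- The features are shared in call 8: the three setup calls and the five calls of the first MAC
check precede it. All nonzero coordinates of a feature vector lie among the first n·k. -/
theorem featuresOf_eq (p : Fin 3) (X : S.Features) {h : List (Event K)}
    {a : (Fshare K S.Features S.fo).Reply × (Fin 3 → Bool)}
    (hh : h[8]? = some ⟨Fshare K S.Features S.fo, (), a⟩) :
    featuresOf S p X h = if p = S.fo then a.1.1 else X := by
  unfold featuresOf
  split_ifs with hp
  · have : evalList ⟨0, 0, h, 0⟩ (inputExprs S p) = Code.enc (K := K) (α := S.Features) a.1.1 := by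
      funext j
      have hp' : ¬p = S.mo := fun H => S.mo_ne_fo (H.symm.trans hp)
      rw [inputExprs, if_neg hp', if_pos hp, evalList_map_range]
      split_ifs with hj
      · rw [eval_msg hh]
        exact enc_pair_four (α := S.Features) (β := Sh S.Features) a j
      · exact (enc_tuple_eq_zero (B := S.k) enc_word_eq_zero _ (by omega)).symm
    rw [this, Code.dec_enc]
  · rfl

end Extraction

/-! ### The execution is close to the hybrid process -/

section Comparison

variable {K : Type} [Field K] [Fintype K] [DecidableEq K] {S : Setting K}

/-- The protocol selects arithmetically: for b = 1 the multiplexer gives r + (l + r) = l in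
characteristic 2. -/
theorem walk_succ (T : S.TreeArray) (X : S.Features) (j : ℕ) :
    S.walk T X (j + 1) = T (S.pos (S.mux
      (S.less (S.innerProd (X, S.sel (S.walk T X j)), S.thr (S.walk T X j)),
        S.left (S.walk T X j), S.right (S.walk T X j)))) := by
  rw [Setting.walk]
  congr 2
  simp only [Setting.less, Setting.mux]
  split_ifs
  · funext i
    have h (a b : ZMod 2) : a = b + 1 * (a + b) := by revert a b; decide
    exact h _ _
  · simp

/-- The situation after `j` iterations, for every value of the MAC key: the selected pairs have
errors `ε i - α * δ i`. -/
structure Iterated (T : S.TreeArray) (X : S.Features) (j : ℕ) (h : List (Event K))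
    (u : K → Vals S) (ν : K) (δ ε : Fin S.dpad → K) : Prop where
  key : ∀ α, (u α).key = α
  tree : ∀ α, (u α).T = T
  mac : ∀ α i, (u α).M i = α * T i
  feat : ∀ α, (u α).X = X
  node : ∀ α, (u α).node = ν
  defect : ∀ α (i : Fin S.dpad), (i : ℕ) < j →
    ((u α).picked i).2 = α * ((u α).picked i).1 + (ε i - α * δ i)
  clean : Clean h ↔ ∀ i : Fin S.dpad, (i : ℕ) < j → δ i = 0 ∧ ε i = 0
  walk : Clean h → ν = S.walk T X j
  result : 0 < j → ∀ α, (u α).result = S.cls ν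

/-- An iteration in the hybrid process. -/
def iterationHybrid (S : Setting K) : List (HStep K) :=
  [ { F := F3pc K S.innerProd, leak := fun _ => (), check := false },
    { F := F3pc K S.less, leak := fun _ => (), check := false },
    { F := F3pc K S.mux, leak := fun _ => (), check := false },
    { F := Fos K (Word S.k) (K × K) S.m S.pos, leak := fun _ => (), check := false } ]

/-- All that steers the iteration (node, features, array) is independent of α. The selected pair (T
q + e₁, α T q + e₂) has the defect e₂ − α e₁, so the errors of this call become the new entries of δ
and ε. -/
theorem iteration_within {R : Type*} (p : Fin 3) (A : Adversary K)
    (onAbort : List (Event K) → PMF R) {T : S.TreeArray} {X : S.Features} (i : Fin S.dpad)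
    {h : List (Event K)} {u : K → Vals S} {ν : K} {δ ε : Fin S.dpad → K}
    (I : Iterated T X i h u ν δ ε)
    {cont : List (Event K) → Vals S → PMF R} {cont' : List (Event K) → PMF R} {η : ℝ≥0∞}
    (hcont : ∀ h' u' ν' δ' ε', h <+: h' → Iterated T X (i + 1) h' u' ν' δ' ε' →
      Within η ((unif K).bind fun α => cont h' (u' α)) (cont' h')) :
    Within η ((unif K).bind fun α => play (some p) A onAbort (iterationValues S i) cont h (u α))
      (hplay p A onAbort (iterationHybrid S) cont' h) := by
  classical
  simp only [iterationValues, play, iterationHybrid, hplay, PMF.pure_bind, replyTo, I.node, I.feat,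
    I.tree]
  refine within_step_left (fun a => by simp) rfl fun x₁ _ => ?_
  refine within_step_left (fun a => by simp) rfl fun x₂ _ => ?_
  refine within_step_left (fun a => by simp) rfl fun x₃ _ => ?_
  refine within_step_left (fun a => by simp) rfl fun x₄ _ => ?_
  set q := S.pos (S.mux (S.less (S.innerProd (X, S.sel ν), S.thr ν), S.left ν, S.right ν)) with hq
  refine hcont _ _ (T q + x₄.1.1.1) (Function.update δ i x₄.1.1.1)
    (Function.update ε i x₄.1.1.2) ?_ ?_
  · simp only [List.append_assoc]
    exact List.prefix_append _ _
  have hc : Clean (h ++ [⟨F3pc K S.innerProd, (), x₁⟩] ++ [⟨F3pc K S.less, (), x₂⟩]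
      ++ [⟨F3pc K S.mux, (), x₃⟩] ++ [⟨Fos K (Word S.k) (K × K) S.m S.pos, (), x₄⟩])
      ↔ Clean h ∧ x₄.1.1.1 = 0 ∧ x₄.1.1.2 = 0 := by
    simp only [clean_append, clean_singleton]
    simp only [F3pc, Fos, not_false_eq_true, and_true, not_not]
    exact and_congr_right fun _ => Prod.ext_iff
  refine ⟨fun α => I.key α, fun α => rfl, fun α j => I.mac α j, fun α => rfl,
    fun α => rfl, fun α l hl => ?_, ?_, fun H => ?_, fun _ α => rfl⟩
  · dsimp only
    by_cases hli : l = i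
    · subst hli
      simp only [Function.update_self, I.mac]
      ring
    · simp only [Function.update_of_ne hli]
      refine I.defect α l ?_
      have := Fin.val_ne_of_ne hli
      omega
  · rw [hc, I.clean]
    constructor
    · rintro ⟨H, h1, h2⟩ l hl
      by_cases hli : l = i
      · subst hli
        simp only [Function.update_self]
        exact ⟨h1, h2⟩
      · simp only [Function.update_of_ne hli]
        have := Fin.val_ne_of_ne hli
        exact H l (by omega)
    · intro H
      refine ⟨fun l hl => ?_, by simpa using H i (by omega)⟩
      have hli : l ≠ i := fun e => by subst e; omega
      simpa only [Function.update_of_ne hli] using H l (by omega)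
  · obtain ⟨h0, h1, -⟩ := hc.1 H
    rw [h1, add_zero, walk_succ, ← I.walk h0]

/-- The list of remaining iterations is kept as a suffix of `List.finRange`, so that its head is the
iteration that the invariant `Iterated` expects. -/
theorem iterations_within {R : Type*} (p : Fin 3) (A : Adversary K)
    (onAbort : List (Event K) → PMF R) {T : S.TreeArray} {X : S.Features} (L : List (Fin S.dpad))
    (j : ℕ) (hL : (List.finRange S.dpad).drop j = L) (hj : j ≤ S.dpad)
    {h : List (Event K)} {u : K → Vals S} {ν : K} {δ ε : Fin S.dpad → K}
    (I : Iterated T X j h u ν δ ε)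
    {cont : List (Event K) → Vals S → PMF R} {cont' : List (Event K) → PMF R} {η : ℝ≥0∞}
    (hcont : ∀ h' u' ν' δ' ε', h <+: h' → Iterated T X S.dpad h' u' ν' δ' ε' →
      Within η ((unif K).bind fun α => cont h' (u' α)) (cont' h')) :
    Within η
      ((unif K).bind fun α => play (some p) A onAbort (L.flatMap (iterationValues S)) cont h (u α))
      (hplay p A onAbort (L.flatMap fun _ => iterationHybrid S) cont' h) := by
  induction L generalizing j h u ν δ ε with
  | nil =>
    have : S.dpad ≤ j := by simpa using hL
    obtain rfl : j = S.dpad := le_antisymm hj this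
    exact hcont h u ν δ ε List.prefix_rfl I
  | cons i L ih =>
    have hlt : j < (List.finRange S.dpad).length := by
      by_contra H
      rw [List.drop_of_length_le (by omega)] at hL
      cases hL
    rw [List.drop_eq_getElem_cons hlt] at hL
    obtain ⟨hi, hL'⟩ := List.cons.inj hL
    have hij : (i : ℕ) = j := by rw [← hi]; simp
    subst hij
    simp only [List.flatMap_cons, play_append, hplay_append]
    refine iteration_within p A onAbort i I fun h' u' ν' δ' ε' hh I' => ?_
    exact ih (i + 1) hL' i.isLt I' fun h'' u'' ν'' δ'' ε'' hh' I'' =>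
      hcont h'' u'' ν'' δ'' ε'' (hh.trans hh') I''

end Comparison

/-! ### The whole execution and the hybrid process -/

section Real

variable {K : Type} [Field K] [Fintype K] [DecidableEq K] {S : Setting K}

open Classical in
/-- The record of a finished execution. -/
def record (c : Option (Fin 3)) (q : List (Event K) × (Fin 3 → Option (PState S))) : Record S :=
  (if c = none then [] else q.1,
    fun i => if c = some i then .done else
      match q.2 i with
      | none => .aborted
      | some s =>
        match s.output with
        | none => .done
        | some w => .result w)

/-- The reconstruction of `w`. -/
def finish (c : Option (Fin 3)) (A : Adversary K) (h : List (Event K)) (w : Word S.k) :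
    PMF (Record S) :=
  (replyTo c A h (Frecon K (Word S.k) S.fo) (if c = some S.fo then w else (0 : Word S.k))).bind
    fun x => PMF.pure
      (if c = none then [] else
        h ++ [⟨Frecon K (Word S.k) S.fo, if c = some S.fo then w else (0 : Word S.k), x⟩],
      fun i => if c = some i then .done else if x.2 i = true then
        (if i = S.fo then .result w else .done) else .aborted)

theorem recon_eq_finish (c : Option (Fin 3)) (A : Adversary K) (h : List (Event K))
    (σ : Fin 3 → Option (PState S)) (st : Fin 3 → PState S) (u : Vals S)
    (hσ : ∀ i, c ≠ some i → σ i = some (st i)) (hu : Holds c st u) :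
    (exec c A [reconStep S] h σ).map (record c) = finish c A h u.result := by
  classical
  have hs : secret c (fun i => ((σ i).getD default).result) = u.result := by
    rw [secret_congr c (s' := fun i => (st i).result) fun i hi => by rw [hσ i hi]; rfl, hu.2]
    rfl
  rw [exec, if_pos fun i hi => by rw [hσ i hi]; rfl]
  simp only [reconStep, Frecon, PMF.pure_bind, hs, exec, PMF.map_bind, PMF.pure_map]
  unfold finish
  congr 1
  funext x
  congr 1
  refine Prod.ext ?_ ?_
  · simp only [record, Frecon, eq_comm]
  funext i
  simp only [record]
  by_cases hc : c = some i
  · simp only [if_pos hc]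
  · simp only [if_neg hc, hσ i hc, Option.bind_some]
    by_cases hx : x.2 i = true
    · simp only [if_pos hx]
      by_cases hi : i = S.fo <;> simp [hi]
    · simp only [if_neg hx]

theorem real_eq_play (c : Option (Fin 3)) (A : Adversary K) (T : S.TreeArray) (X : S.Features) :
    real S c A T X = play c A (fun h => PMF.pure (record c (h, fun _ => none)))
      (protocolValues S c) (fun h u => finish c A h u.result) [] (valsOf c (initial S T X) 0) := by
  have := exec_eq_play c A (protocolValues S c) protocolValues_sound (reconStep S) [] (record c)
    (fun h u => finish c A h u.result)
    (fun h σ st u hσ hu => recon_eq_finish c A h σ st u hσ hu) []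
    (fun i => some (initial S T X i)) (initial S T X) (valsOf c (initial S T X) 0)
    (fun _ _ => rfl) ⟨fun _ _ => rfl, rfl⟩
  rw [← this, ← protocol_eq]
  rfl

/-- All honest parties abort. -/
def abortAll (p : Fin 3) (h : List (Event K)) : Record S :=
  (h, fun i => if i = p then .done else .aborted)

theorem record_none (p : Fin 3) (h : List (Event K)) :
    record (S := S) (some p) (h, fun _ => none) = abortAll p h := by
  refine Prod.ext rfl ?_
  funext i
  simp [record, abortAll, eq_comm]

/-- The first steps in the hybrid process. -/
def setupHybrid (S : Setting K) : List (HStep K) :=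
  [ { F := Fshare K S.TreeArray S.mo, leak := fun _ => (), check := false },
    { F := Frand K, leak := fun _ => (), check := false },
    { F := Fmul K S.m, leak := fun _ => (), check := false } ]

/-- The steps between the MAC checks in the hybrid process. -/
def evalHybrid (S : Setting K) : List (HStep K) :=
  { F := Fshare K S.Features S.fo, leak := fun _ => (), check := false } ::
    (List.finRange S.dpad).flatMap fun _ => iterationHybrid S

/-- The end of the hybrid process. -/
def finishHybrid (p : Fin 3) (A : Adversary K) (T : S.TreeArray) (X : S.Features)
    (h : List (Event K)) : PMF (Record S) :=
  finish (some p) A h (S.pdte (treeOf S p T h) (featuresOf S p X h))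

/-- The hybrid process. -/
def hybrid (p : Fin 3) (A : Adversary K) (T : S.TreeArray) (X : S.Features) : PMF (Record S) :=
  let onAbort : List (Event K) → PMF (Record S) := fun h => PMF.pure (abortAll p h)
  hplay p A onAbort (setupHybrid S) (fun h => (unif ((Fin S.m → Kˣ) × K)).bind fun t =>
    hplay p A onAbort (macHybrid S.m t.1 t.2) (fun h => hplay p A onAbort (evalHybrid S)
      (fun h => (unif ((Fin S.dpad → Kˣ) × K)).bind fun t =>
        hplay p A onAbort (macHybrid S.dpad t.1 t.2) (finishHybrid p A T X) h) h) h) []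

/-- The soundness error of a MAC check. -/
def macError (K : Type) [Fintype K] : ℝ≥0∞ :=
  (1 : ℕ) / (Fintype.card K : ℕ) + (2 : ℕ) / (Fintype.card K : ℕ)

theorem getElem?_of_prefix {α : Type*} {l l' : List α} (h : l <+: l') {i : ℕ} {a : α}
    (hl : l[i]? = some a) : l'[i]? = some a := by
  obtain ⟨t, rfl⟩ := h
  rw [List.getElem?_append_left]
  · exact hl
  · by_contra H
    rw [List.getElem?_eq_none (by omega)] at hl
    cases hl

/-- The evaluation phase, for a public tree array with correct MACs. -/
theorem eval_within (p : Fin 3) (A : Adversary K) (T T' : S.TreeArray) (X : S.Features)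
    {h : List (Event K)} (hlen : h.length = 8) (hclean : Clean h) {u : K → Vals S}
    (hkey : ∀ α, (u α).key = α) (hT : ∀ α, (u α).T = T') (hM : ∀ α i, (u α).M i = α * T' i)
    (hX : ∀ α, (u α).inX = if p = S.fo then 0 else X)
    (htree : ∀ h', h <+: h' → treeOf S p T h' = T') :
    Within (macError K)
      ((unif K).bind fun α => play (some p) A (fun h => PMF.pure (abortAll p h))
        (featureValues S (some p) :: ((List.finRange S.dpad).flatMap (iterationValues S)
          ++ macValues S S.dpad (fun s j => s.picked j) fun u j => u.picked j))
        (fun h u => finish (some p) A h u.result) h (u α))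
      (hplay p A (fun h => PMF.pure (abortAll p h)) (evalHybrid S)
        (fun h => (unif ((Fin S.dpad → Kˣ) × K)).bind fun t =>
          hplay p A (fun h => PMF.pure (abortAll p h)) (macHybrid S.dpad t.1 t.2)
            (finishHybrid p A T X) h) h) := by
  classical
  simp only [evalHybrid, featureValues, play, hplay, PMF.pure_bind, replyTo, play_append, hT, hX]
  refine within_step_left (fun a => by simp) rfl fun x₉ _ => ?_
  -- The middle case never arises; it stems from `valsOf`, which blanks the input of a corrupted
  -- dealer.
  set X' : S.Features := if some p = some S.fo then x₉.1.1 else if p = S.fo then 0 else X with hX'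
  have hfeat (h' : List (Event K)) (hh : h ++ [⟨Fshare K S.Features S.fo, (), x₉⟩] <+: h') :
      featuresOf S p X h' = X' := by
    rw [featuresOf_eq S p X (a := x₉) (getElem?_of_prefix hh (by
      rw [List.getElem?_append_right hlen.le, hlen]; rfl)), hX']
    by_cases hp : p = S.fo
    · rw [if_pos hp, if_pos (by rw [hp])]
    · rw [if_neg hp, if_neg (by simpa using hp), if_neg hp]
  refine iterations_within p A _ (T := T') (X := X') (List.finRange S.dpad) 0 rfl
    (Nat.zero_le _) (ν := T' ⟨0, Nat.two_pow_pos _⟩) (δ := 0) (ε := 0) ?_ ?_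
  · refine ⟨fun α => hkey α, fun α => rfl, fun α i => hM α i, fun α => rfl, fun α => rfl,
      fun α i hi => absurd hi (Nat.not_lt_zero _), ?_, fun _ => rfl,
      fun h => absurd h (lt_irrefl _)⟩
    refine iff_of_true ?_ fun i hi => absurd hi (Nat.not_lt_zero _)
    exact clean_append.2 ⟨hclean, clean_singleton.2 id⟩
  intro h' u' ν δ ε hpre' I
  rw [← zero_add (macError K)]
  refine mac_within p A _ (fun _ _ _ _ _ _ => rfl) (δ := δ) (ε := ε) I.key
    (fun α j => I.defect α j j.isLt) ?_ ?_
  · rw [I.clean]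
    constructor
    · exact fun H => ⟨funext fun i => (H i i.isLt).1, funext fun i => (H i i.isLt).2⟩
    · rintro ⟨rfl, rfl⟩ i -
      exact ⟨rfl, rfl⟩
  intro h'' hpre'' _ hclean'' r sr v w vo
  have hclean' : Clean h' := fun e he => hclean'' e (hpre''.subset he)
  have h1 : treeOf S p T h'' = T' := htree _
    ((List.prefix_append _ _).trans (hpre'.trans hpre''))
  have h2 : featuresOf S p X h'' = X' := hfeat _ (hpre'.trans hpre'')
  -- Here d_pad ≥ 1 matters: `result` is set only by an iteration. The final value is now the same
  -- for all keys, so the average over α disappears.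
  simp only [I.result S.dpad_pos, finishHybrid, h1, h2, I.walk hclean', Setting.pdte,
    PMF.bind_const]
  exact Within.refl _

/-- Sharing the tree admits no error, so the first check has δ = 0, and ε consists of the errors of
the setup multiplications. A clean check thus means correct MACs, which is what the evaluation phase
starts from. -/
theorem real_within_hybrid (p : Fin 3) (A : Adversary K) (T : S.TreeArray) (X : S.Features) :
    Within (macError K + macError K) (real S (some p) A T X) (hybrid p A T X) := by
  classical
  rw [real_eq_play]
  simp only [record_none]
  unfold protocolValues hybrid
  simp only [play_append]
  have hinT : (valsOf (some p) (initial S T X) 0).inT = if p = S.mo then 0 else T := by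
    simp [valsOf, initial]
  have hinX : (valsOf (some p) (initial S T X) 0).inX = if p = S.fo then 0 else X := by
    simp [valsOf, initial]
  generalize valsOf (some p) (initial S T X) 0 = u₀ at hinT hinX
  simp only [setupValues, setupHybrid, play, hplay, PMF.pure_bind, replyTo]
  refine within_step_same (fun a => by simp) rfl fun x₁ _ => ?_
  refine within_step_left (fun a => by simp) rfl fun x₂ _ => ?_
  refine within_step_left (fun a => by simp) rfl fun x₃ _ => ?_
  simp only [hinT]
  set T' : S.TreeArray := if some p = some S.mo then x₁.1.1 else if p = S.mo then 0 else T with hT'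
  set h₃ : List (Event K) := [] ++ [⟨Fshare K S.TreeArray S.mo, (), x₁⟩]
    ++ [⟨Frand K, (), x₂⟩] ++ [⟨Fmul K S.m, (), x₃⟩] with hh₃
  have htree (h : List (Event K)) (hh : h₃ <+: h) : treeOf S p T h = T' := by
    rw [treeOf_eq S p T (a := x₁) (getElem?_of_prefix hh rfl), hT']
    by_cases hp : p = S.mo
    · rw [if_pos hp, if_pos (by rw [hp])]
    · rw [if_neg hp, if_neg (by simpa using hp), if_neg hp]
  have hclean₃ : Clean h₃ ↔ x₃.1.1 = 0 := by
    rw [hh₃]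
    simp only [clean_append, clean_singleton]
    simp [Fshare, Frand, Fmul, Clean]
  refine mac_within p A _ (fun _ _ _ _ _ _ => rfl) (δ := 0) (ε := x₃.1.1) (fun _ => rfl)
    (fun α j => by simp) (by simpa using hclean₃) ?_
  intro h₈ hpre hlen hclean r sr v w vo
  have hM : x₃.1.1 = 0 := hclean₃.1 fun e he => hclean e (hpre.subset he)
  exact eval_within p A T T' X (by rw [hlen, hh₃]; rfl) hclean (fun _ => rfl) (fun _ => rfl)
    (fun α i => by simp [hM]) (fun _ => hinX) fun h' hh => htree h' (hpre.trans hh)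

end Real

/-! ### Undetected errors do not occur in the hybrid process -/

section Undetected

variable {K : Type} [Field K] [Fintype K] [DecidableEq K] {S : Setting K}

theorem bind_null {Ω Ω' : Type*} (p : PMF Ω) {f : Ω → PMF Ω'} {D : Set Ω'}
    (h : ∀ x, (f x).toOuterMeasure D = 0) : (p.bind f).toOuterMeasure D = 0 := by
  rw [PMF.toOuterMeasure_bind_apply]
  simp [h]

theorem hplay_null {R : Type*} (p : Fin 3) (A : Adversary K) {onAbort : List (Event K) → PMF R}
    {D : Set R} (hAbort : ∀ h, (onAbort h).toOuterMeasure D = 0) (l : List (HStep K))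
    {cont : List (Event K) → PMF R} (hcont : ∀ h, (cont h).toOuterMeasure D = 0)
    (h : List (Event K)) : (hplay p A onAbort l cont h).toOuterMeasure D = 0 := by
  induction l generalizing h with
  | nil => exact hcont h
  | cons s l ih =>
    rw [hplay]
    refine bind_null _ fun x => ?_
    split_ifs
    · exact ih _
    · exact hAbort _

/-- Only clean histories get past the zero test, and that call itself cannot be tampered with. -/
theorem macHybrid_null {R : Type*} (p : Fin 3) (A : Adversary K)
    {onAbort : List (Event K) → PMF R} {D : Set R} (hAbort : ∀ h, (onAbort h).toOuterMeasure D = 0)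
    (N : ℕ) (ρ : Fin N → Kˣ) (v : K) {cont : List (Event K) → PMF R}
    (hcont : ∀ h, Clean h → (cont h).toOuterMeasure D = 0) (h : List (Event K)) :
    (hplay p A onAbort (macHybrid N ρ v) cont h).toOuterMeasure D = 0 := by
  unfold macHybrid
  rw [show ∀ a b c d e : HStep K, [a, b, c, d, e] = [a, b, c, d] ++ [e] from
    fun _ _ _ _ _ => rfl, hplay_append]
  refine hplay_null p A hAbort _ (fun h => ?_) h
  rw [hplay]
  refine bind_null _ fun x => ?_
  split_ifs with hx
  · exact hcont _ (clean_append.2 ⟨hx.2 rfl, clean_singleton.2 id⟩)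
  · exact hAbort _

/-- Every abort before the reconstruction concerns all honest parties. Whoever reaches the end has
passed the last check with a clean history, and the reconstruction admits no error. -/
theorem hybrid_undetected (p : Fin 3) (A : Adversary K) (T : S.TreeArray) (X : S.Features) :
    (hybrid p A T X).toOuterMeasure (undetected S p) = 0 := by
  classical
  have hAbort (h : List (Event K)) :
      (PMF.pure (abortAll (S := S) p h)).toOuterMeasure (undetected S p) = 0 := by
    rw [PMF.toOuterMeasure_pure_apply, if_neg]
    rintro ⟨-, i, hi, hi'⟩
    simp [abortAll, hi] at hi'
  unfold hybrid
  refine hplay_null p A hAbort _ (fun h => bind_null _ fun t => ?_) _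
  refine macHybrid_null p A hAbort _ _ _ (fun h _ => ?_) h
  refine hplay_null p A hAbort _ (fun h => bind_null _ fun t => ?_) _
  refine macHybrid_null p A hAbort _ _ _ (fun h hc => ?_) h
  unfold finishHybrid finish
  refine bind_null _ fun x => ?_
  rw [PMF.toOuterMeasure_pure_apply, if_neg]
  rintro ⟨⟨e, he, ht⟩, -⟩
  refine (clean_append.2 ⟨hc, clean_singleton.2 ?_⟩ : Clean _) e he ht
  exact id

end Undetected

/-! ### Execution without corruption -/

section Honest

variable {K : Type} [Field K] [Fintype K] [DecidableEq K] {S : Setting K}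

/-- Passive replies are free of errors only on the support of their distribution, so the constancy
of the continuation is available only there. -/
theorem bind_eq_of_support {Ω Ω' : Type*} {p : PMF Ω} {f : Ω → PMF Ω'} {q : PMF Ω'}
    (h : ∀ x ∈ p.support, f x = q) : p.bind f = q := by
  have : p.bind f = p.bind fun _ => q := by
    ext b
    rw [PMF.bind_apply, PMF.bind_apply]
    refine tsum_congr fun x => ?_
    by_cases hx : x ∈ p.support
    · rw [h x hx]
    · rw [(PMF.apply_eq_zero_iff p x).2 hx, zero_mul, zero_mul]
  rw [this, PMF.bind_const]

theorem delivered_true : Delivered none (fun _ : Fin 3 => true) := fun _ _ => rfl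

variable {R : Type*} (A : Adversary K) (onAbort : List (Event K) → PMF R)

theorem mac_honest {N : ℕ} {sh : PState S → Fin N → Sh K × Sh K} {get : Vals S → Fin N → K × K}
    (hget : ∀ u r sr v w vo, get { u with r := r, sr := sr, v := v, w := w, vOpen := vo } = get u)
    {h : List (Event K)} {u : Vals S} (hdef : ∀ j, (get u j).2 = u.key * (get u j).1)
    {cont : List (Event K) → Vals S → PMF R} {q : PMF R}
    (hcont : ∀ h' r sr v w vo,
      cont h' { u with r := r, sr := sr, v := v, w := w, vOpen := vo } = q) :
    play none A onAbort (macValues S N sh get) cont h u = q := by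
  simp only [macValues, play, replyTo, PMF.bind_map, Function.comp_def, if_pos delivered_true,
    PMF.pure_bind, hget]
  refine bind_eq_of_support fun r _ => bind_eq_of_support fun _ _ =>
    bind_eq_of_support fun y hy => bind_eq_of_support fun ρ _ => bind_eq_of_support fun _ _ =>
    bind_eq_of_support fun _ _ => bind_eq_of_support fun _ _ => ?_
  have hy0 : y.1 = 0 := by
    simp only [Fmul, PMF.support_map] at hy
    obtain ⟨a, -, rfl⟩ := hy
    rfl
  have hz : r * u.key + y.1 0 + ∑ j, (ρ j : K) * (get u j).2
      - (r + ∑ j, (ρ j : K) * (get u j).1) * u.key = 0 := by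
    have : ∑ j, (ρ j : K) * (get u j).2 = (∑ j, (ρ j : K) * (get u j).1) * u.key := by
      rw [Finset.sum_mul]
      exact Finset.sum_congr rfl fun j _ => by rw [hdef]; ring
    rw [this, hy0, Pi.zero_apply]
    ring
  rw [if_pos hz]
  exact hcont _ _ _ _ _ _

theorem iterations_honest {T : S.TreeArray} {X : S.Features} (L : List (Fin S.dpad)) (j : ℕ)
    (hL : (List.finRange S.dpad).drop j = L) (hj : j ≤ S.dpad) {h : List (Event K)} {u : Vals S}
    (hT : u.T = T) (hM : ∀ i, u.M i = u.key * T i) (hX : u.X = X) (hnode : u.node = S.walk T X j)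
    (hpick : ∀ i : Fin S.dpad, (i : ℕ) < j → (u.picked i).2 = u.key * (u.picked i).1)
    (hres : 0 < j → u.result = S.cls u.node)
    {cont : List (Event K) → Vals S → PMF R} {q : PMF R}
    (hcont : ∀ h' u', (∀ i, (u'.picked i).2 = u'.key * (u'.picked i).1) →
      u'.result = S.pdte T X → cont h' u' = q) :
    play none A onAbort (L.flatMap (iterationValues S)) cont h u = q := by
  induction L generalizing j h u with
  | nil =>
    have : S.dpad ≤ j := by simpa using hL
    obtain rfl : j = S.dpad := le_antisymm hj this
    exact hcont h u (fun i => hpick i i.isLt) (by rw [hres S.dpad_pos, hnode]; rfl)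
  | cons i L ih =>
    have hlt : j < (List.finRange S.dpad).length := by
      by_contra H
      rw [List.drop_of_length_le (by omega)] at hL
      cases hL
    rw [List.drop_eq_getElem_cons hlt] at hL
    obtain ⟨hi, hL'⟩ := List.cons.inj hL
    have hij : (i : ℕ) = j := by rw [← hi]; simp
    subst hij
    rw [List.flatMap_cons, play_append]
    simp only [iterationValues, play, replyTo, PMF.bind_map, Function.comp_def,
      if_pos delivered_true, PMF.pure_bind]
    refine bind_eq_of_support fun _ _ => bind_eq_of_support fun _ _ =>
      bind_eq_of_support fun _ _ => bind_eq_of_support fun y hy => ?_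
    have hy0 : y.1 = 0 := by
      simp only [Fos, PMF.support_map] at hy
      obtain ⟨a, -, rfl⟩ := hy
      rfl
    have h1 : y.1.1 = 0 := by rw [hy0]; rfl
    have h2 : y.1.2 = 0 := by rw [hy0]; rfl
    refine ih (i + 1) hL' i.isLt ?_ ?_ ?_ ?_ ?_ ?_
    · exact hT
    · exact hM
    · exact hX
    · simp only [h1, hnode, hX, hT]
      rw [add_zero, walk_succ]
    · intro l hl
      dsimp only
      by_cases hli : l = i
      · subst hli
        simp only [Function.update_self, h1, h2, hT, hM, add_zero]
      · simp only [Function.update_of_ne hli]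
        refine hpick l ?_
        have := Fin.val_ne_of_ne hli
        omega
    · exact fun _ => rfl

/-- Without errors the tested value is zero for every key, mask and coefficients, and all answers
are delivered; so all random choices lead to the same record. -/
theorem real_honest (T : S.TreeArray) (X : S.Features) :
    real S none A T X
      = PMF.pure ([], fun i => if i = S.fo then .result (S.pdte T X) else .done) := by
  rw [real_eq_play]
  unfold protocolValues
  simp only [play_append]
  have hinT : (valsOf none (initial S T X) 0).inT = T := by simp [valsOf, initial]
  have hinX : (valsOf none (initial S T X) 0).inX = X := by simp [valsOf, initial]
  generalize valsOf none (initial S T X) 0 = u₀ at hinT hinX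
  simp only [setupValues, featureValues, play, replyTo, PMF.bind_map, Function.comp_def,
    if_pos delivered_true, PMF.pure_bind, play_append]
  refine bind_eq_of_support fun _ _ => bind_eq_of_support fun α _ =>
    bind_eq_of_support fun _ _ => bind_eq_of_support fun y hy => ?_
  have hy0 : y.1 = 0 := by
    simp only [Fmul, PMF.support_map] at hy
    obtain ⟨a, -, rfl⟩ := hy
    rfl
  have hy1 (j : Fin S.m) : y.1 j = 0 := by rw [hy0]; rfl
  refine mac_honest A _ (fun _ _ _ _ _ _ => rfl) (fun j => ?_) fun h' r sr v w vo => ?_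
  · simp only [hy1, add_zero]
  refine bind_eq_of_support fun _ _ => ?_
  refine iterations_honest A _ (T := T) (X := X) _ 0 rfl (Nat.zero_le _) ?_ (fun i => ?_) ?_ ?_
    (fun i hi => absurd hi (Nat.not_lt_zero _)) (fun hi => absurd hi (lt_irrefl _)) ?_
  · simp [hinT]
  · simp only [hy1, add_zero, hinT]
    simp
  · simp [hinX]
  · simp [hinT, Setting.walk]
  intro h'' u' hp hr
  refine mac_honest A _ (fun _ _ _ _ _ _ => rfl) hp fun h₃ r sr v w vo => ?_
  simp only [hr, finish, replyTo, PMF.bind_map, Function.comp_def]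
  refine bind_eq_of_support fun _ _ => ?_
  congr 1

end Honest

/-! ### The simulator -/

section Simulation

variable {K : Type} [Field K] [DecidableEq K]

/-- A formula that is zero iff all the given ones are. -/
def zeroAll : List (Expr K) → Expr K
  | [] => .const 0
  | e :: es => .ifZero e (zeroAll es) (.const 1)

theorem zeroAll_eval (E : Env K) (l : List (Expr K)) :
    (zeroAll l).eval E = 0 ↔ ∀ e ∈ l, e.eval E = 0 := by
  induction l with
  | nil => simp [zeroAll, Expr.eval]
  | cons e l ih =>
    rw [zeroAll, Expr.eval]
    by_cases h : e.eval E = 0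
    · simp [h, ih]
    · simp [h, Expr.eval]

/-- Nonzero errors can be read off `N` coordinates of the reply. -/
def TamperCode (F : Functionality K) (N : ℕ) : Prop :=
  haveI := F.codeReply
  ∀ a : F.Reply × (Fin 3 → Bool), F.tampers a.1 ↔ ∃ j < N, Code.enc (K := K) a (4 * j) ≠ 0

/-- The coordinates of the errors in the first `t` calls, if call `s` has `L s` of them. -/
def errors (L : ℕ → ℕ) (t : ℕ) : List (Expr K) :=
  (List.range t).flatMap fun s => (List.range (L s)).map fun j => .msg s (4 * j)

/-- The environment may know more than `h`: the verdict of a check concerns the calls before it, but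
the simulator acts on it after having seen the reply to the check. -/
theorem clean_iff_errors {L : ℕ → ℕ} {h : List (Event K)} (E : Env K) (hE : h <+: E.hist)
    (hL : ∀ (t : ℕ) (e : Event K), h[t]? = some e → TamperCode e.F (L t)) :
    Clean h ↔ ∀ x ∈ errors L h.length, x.eval E = 0 := by
  simp only [errors, List.mem_flatMap, List.mem_map, List.mem_range, Clean]
  have key (t : ℕ) (e : Event K) (he : h[t]? = some e) :
      e.F.tampers e.reply.1 ↔ ∃ j < L t, (Expr.msg t (4 * j)).eval E ≠ 0 := by
    rw [hL t e he e.reply]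
    refine exists_congr fun j => and_congr_right fun _ => ?_
    rw [eval_msg (getElem?_of_prefix hE he)]
  constructor
  · rintro H x ⟨t, ht, j, hj, rfl⟩
    by_contra hx
    have he : h[t]? = some h[t] := List.getElem?_eq_getElem ht
    exact H _ (List.getElem_mem ht) ((key t _ he).2 ⟨j, hj, hx⟩)
  · intro H e he ht
    obtain ⟨t, htl, rfl⟩ := List.mem_iff_getElem.1 he
    obtain ⟨j, hj, hx⟩ := (key t _ (List.getElem?_eq_getElem htl)).1 ht
    exact hx (H _ ⟨t, htl, j, hj, rfl⟩)

/-- What the simulator does in a call: the leak, given the number of the call, and whether it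
halts afterwards in case of tampering. -/
structure SimStep (K : Type) where
  leak : ℕ → List (Expr K)
  check : Bool

/-- Zero iff the parties other than `p` receive their answer in call `t`. -/
def undelivered (p : Fin 3) (t : ℕ) : List (Expr K) :=
  ((List.finRange 3).filter (· ≠ p)).map fun i : Fin 3 =>
    .ifZero (.msg t (2 * (i : ℕ) + 1)) (.const 1) (.const 0)

/-- The flags are the second component of a message, hence at odd positions, and the bit of flag i
is coordinate i of the interleaved triple. -/
theorem eval_delivery {E : Env K} {t : ℕ} {F : Functionality K} {y : F.Leak}
    {a : F.Reply × (Fin 3 → Bool)} (h : E.hist[t]? = some ⟨F, y, a⟩) (i : Fin 3) :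
    (Expr.msg t (2 * (i : ℕ) + 1)).eval E = if a.2 i = true then 1 else 0 := by
  rw [eval_msg h]
  let := F.codeReply
  rw [enc_pair_odd, enc_tuple, dif_pos (by omega)]
  have h1 : (⟨(i : ℕ) % 3, Nat.mod_lt _ (by omega)⟩ : Fin 3) = i :=
    Fin.ext (Nat.mod_eq_of_lt i.isLt)
  rw [h1, Nat.div_eq_of_lt i.isLt]
  show (if 0 = 0 ∧ a.2 i = true then (1 : K) else 0) = _
  simp

theorem undelivered_eval {p : Fin 3} {E : Env K} {t : ℕ} {F : Functionality K}
    {y : F.Leak} {a : F.Reply × (Fin 3 → Bool)} (h : E.hist[t]? = some ⟨F, y, a⟩) :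
    (∀ x ∈ undelivered p t, x.eval E = 0) ↔ Delivered (some p) a.2 := by
  simp only [undelivered, List.mem_map, List.mem_filter, List.mem_finRange, true_and,
    decide_eq_true_eq, forall_exists_index, and_imp, forall_apply_eq_imp_iff₂, Delivered]
  refine forall_congr' fun i => ?_
  have : i ≠ p ↔ some p ≠ some i := by simp [eq_comm]
  rw [this]
  refine imp_congr_right fun _ => ?_
  rw [Expr.eval, eval_delivery h]
  by_cases hi : a.2 i = true <;> simp [hi, Expr.eval]

variable (S : Setting K)

/-- The simulator with given steps, where `L` tells the numbers of error coordinates. -/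
def simulator (p : Fin 3) (L : ℕ → ℕ) (l : List (SimStep K)) (last : SimStep K) :
    Simulator K where
  coins := S.m + (S.dpad + 2)
  query := l.length
  halt t := if t = 0 then .const 0 else zeroAll (undelivered p (t - 1) ++
    if ((l ++ [last])[t - 1]?).elim false SimStep.check then errors L (t - 1) else [])
  leak t := ((l ++ [last])[t]?).elim [] fun s => s.leak t
  input := inputExprs S p
  deliver i := .msg l.length (2 * (i : ℕ) + 1)

/-- A simulator step reproduces the leak of a step of the hybrid process. -/
def Fits (L : ℕ → ℕ) (coin unitCoin : ℕ → K) (s : HStep K) (e : SimStep K) : Prop :=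
  s.check = e.check ∧ ∀ h : List (Event K),
    (∀ E : Env K, E.hist = h → (Clean h ↔ ∀ x ∈ errors L h.length, x.eval E = 0)) →
      (haveI := s.F.codeLeak
       Code.dec (evalList ⟨coin, unitCoin, h, fun _ => 0⟩ (e.leak h.length))) = s.leak h

/-- The simulator decides at the start of a call whether the preceding one allows it to go on. After
the last call of `hs` this decision is still pending, so it is left to `kont`, which must act as
`cont` or as `onAbort` accordingly. `hlive` says that the pending decision is to go on. -/
theorem chat_eq_hplay {R : Type*} (p : Fin 3) (A : Adversary K)
    (onAbort cont kont : List (Event K) → PMF R) {L : ℕ → ℕ} {coin unitCoin : ℕ → K}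
    {hs : List (HStep K)} {l : List (SimStep K)} (last : SimStep K)
    (hfit : List.Forall₂ (Fits L coin unitCoin) hs l)
    (hL : ∀ (t : ℕ) (F : Functionality K), (hs.map HStep.F)[t]? = some F → TamperCode F (L t))
    (hkont : ∀ h, h.map Event.F = hs.map HStep.F →
      (((simulator S p L l last).halt h.length).eval ⟨coin, unitCoin, h, fun _ => 0⟩ = 0 →
        kont h = cont h) ∧
      (((simulator S p L l last).halt h.length).eval ⟨coin, unitCoin, h, fun _ => 0⟩ ≠ 0 →
        kont h = onAbort h))
    (suf pre : List (HStep K)) (hps : hs = pre ++ suf) (h : List (Event K))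
    (hh : h.map Event.F = pre.map HStep.F)
    (hlive : ((simulator S p L l last).halt h.length).eval ⟨coin, unitCoin, h, fun _ => 0⟩ = 0) :
    ((chat (simulator S p L l last) A coin unitCoin (fun _ => 0) (suf.map HStep.F) h).bind
      fun q => if q.2 = false then onAbort q.1 else kont q.1) = hplay p A onAbort suf cont h := by
  classical
  induction suf generalizing pre h with
  | nil =>
    rw [List.map_nil, chat, PMF.pure_bind]
    simp only [Bool.true_eq_false, if_false, hplay]
    exact (hkont h (by rw [hh, hps, List.append_nil])).1 hlive
  | cons s suf ih =>
    have hlen : h.length = pre.length := by simpa using congrArg List.length hh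
    obtain ⟨hll, hget⟩ := List.forall₂_iff_get.1 hfit
    have hs1 : h.length < hs.length := by rw [hps, hlen]; simp
    have hl1 : h.length < l.length := hll ▸ hs1
    have hsget : hs[h.length] = s := by simp [hps, hlen]
    have hf := hget h.length hs1 hl1
    simp only [List.get_eq_getElem, hsget] at hf
    have hlget : (l ++ [last])[h.length]? = some l[h.length] := by
      rw [List.getElem?_append_left hl1, List.getElem?_eq_getElem hl1]
    have hcode (t : ℕ) (e : Event K) (he : h[t]? = some e) : TamperCode e.F (L t) := by
      refine hL t e.F ?_
      have h1 : (h.map Event.F)[t]? = some e.F := by rw [List.getElem?_map, he]; rfl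
      rw [hh] at h1
      rw [hps, List.map_append]
      exact getElem?_of_prefix (List.prefix_append _ _) h1
    have hleak : (haveI := s.F.codeLeak
        Code.dec (evalList ⟨coin, unitCoin, h, fun _ => 0⟩
          ((simulator S p L l last).leak h.length))) = s.leak h := by
      have := hf.2 h fun E hE => clean_iff_errors E (by rw [hE]) hcode
      simp only [simulator, hlget, Option.elim_some]
      exact this
    rw [List.map_cons, chat]
    simp only [if_pos hlive, hplay]
    rw [PMF.bind_bind]
    rw [hleak]
    congr 1
    funext x
    set h' := h ++ [(⟨s.F, s.leak h, x⟩ : Event K)] with hh'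
    have hlen' : h'.length = h.length + 1 := by simp [hh']
    have hx : h'[h.length]? = some ⟨s.F, s.leak h, x⟩ := by simp [hh']
    have hF' : h'.map Event.F = (pre ++ [s]).map HStep.F := by
      rw [hh', List.map_append, List.map_append, hh]
      rfl
    -- The event of the present call is not searched for errors: the verdict was formed on `h`,
    -- before the reply.
    have hhalt : ((simulator S p L l last).halt h'.length).eval ⟨coin, unitCoin, h', fun _ => 0⟩
        = 0 ↔ Delivered (some p) x.2 ∧ (s.check = true → Clean h) := by
      simp only [simulator, hlen', Nat.add_one_ne_zero, if_false, Nat.add_sub_cancel, hlget,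
        Option.elim_some, ← hf.1]
      rw [zeroAll_eval]
      simp only [List.mem_append, or_imp, forall_and]
      rw [undelivered_eval (E := ⟨coin, unitCoin, h', fun _ => 0⟩) hx]
      refine and_congr_right fun _ => ?_
      by_cases hc : s.check = true
      · rw [if_pos hc, ← clean_iff_errors ⟨coin, unitCoin, h', fun _ => 0⟩
          (List.prefix_append _ _) hcode]
        simp [hc]
      · simp [hc]
    by_cases hd : Delivered (some p) x.2 ∧ (s.check = true → Clean h)
    · rw [if_pos hd]
      exact ih (pre ++ [s]) (by rw [hps]; simp) h' hF' (hhalt.2 hd)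
    · rw [if_neg hd]
      have hn := mt hhalt.1 hd
      cases suf with
      | nil =>
        rw [List.map_nil, chat, PMF.pure_bind]
        simp only [Bool.true_eq_false, if_false]
        exact (hkont h' (by rw [hF', hps])).2 hn
      | cons s' suf =>
        rw [List.map_cons, chat]
        simp only [if_neg hn, PMF.pure_bind, if_true]

end Simulation

section Concrete

variable {K : Type} [Field K] [Fintype K] [DecidableEq K] (S : Setting K)

/-! ### The simulator of the protocol -/

/-- The steps of the hybrid process. -/
def hybridSteps (t : (Fin S.m → Kˣ) × K) (t' : (Fin S.dpad → Kˣ) × K) : List (HStep K) :=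
  setupHybrid S ++ (macHybrid S.m t.1 t.2 ++ (evalHybrid S ++ macHybrid S.dpad t'.1 t'.2))

/-- A call without a leak. -/
def silent : SimStep K := ⟨fun _ => [], false⟩

/-- The simulation of a MAC check; `b` and `b'` are positions on the random tape. -/
def macSim (L : ℕ → ℕ) (N b b' : ℕ) : List (SimStep K) :=
  [ silent, silent,
    ⟨fun _ => (List.range N).map fun i => .unitCoin (b + i), false⟩,
    ⟨fun _ => [.coin b'], false⟩,
    ⟨fun t => [.ifZero (zeroAll (errors L t)) (.const 1) (.const 0)], true⟩ ]

/-- The simulation of the protocol without the last step. -/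
def simSteps (L : ℕ → ℕ) : List (SimStep K) :=
  [silent, silent, silent] ++ (macSim L S.m 0 (S.m + S.dpad) ++
    ((silent :: (List.finRange S.dpad).flatMap fun _ => [silent, silent, silent, silent])
      ++ macSim L S.dpad S.m (S.m + S.dpad + 1)))

/-- The simulation of the reconstruction. -/
def reconSim (p : Fin 3) : SimStep K :=
  ⟨fun _ => if p = S.fo then (List.range S.k).map .out else [], false⟩

variable {S}

theorem silent_fits {L : ℕ → ℕ} {coin unitCoin : ℕ → K} (s : HStep K) (hc : s.check = false)
    (hs : ∀ y y' : s.F.Leak, y = y') : Fits L coin unitCoin s silent :=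
  ⟨hc, fun _ _ => hs _ _⟩

theorem macSim_fits (L : ℕ → ℕ) {coin unitCoin : ℕ → K} {N b b' : ℕ} {ρ : Fin N → Kˣ} {v : K}
    (hρ : ∀ j : Fin N, unitCoin (b + j) = ρ j) (hv : coin b' = v) :
    List.Forall₂ (Fits L coin unitCoin) (macHybrid N ρ v) (macSim L N b b') := by
  classical
  refine .cons (silent_fits _ rfl fun _ _ => rfl) (.cons (silent_fits _ rfl fun _ _ => rfl)
    (.cons ⟨rfl, fun h _ => ?_⟩ (.cons ⟨rfl, fun h _ => ?_⟩ (.cons ⟨rfl, fun h hh => ?_⟩ .nil))))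
  · have : evalList ⟨coin, unitCoin, h, fun _ => 0⟩
        ((List.range N).map fun i => Expr.unitCoin (K := K) (b + i))
        = @Code.enc K ‹Field K› (Fin N → Kˣ) _ ρ := by
      funext j
      rw [evalList_map_range, enc_tuple]
      by_cases hj : j < N
      · rw [if_pos hj, dif_pos (by omega)]
        have h1 : (⟨j % N, Nat.mod_lt _ (by omega)⟩ : Fin N) = ⟨j, hj⟩ :=
          Fin.ext (Nat.mod_eq_of_lt hj)
        rw [h1, Nat.div_eq_of_lt hj]
        exact (hρ ⟨j, hj⟩).trans (if_pos rfl).symm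
      · rw [if_neg hj]
        split_ifs with hN
        · have : j / N ≠ 0 := (Nat.div_pos (by omega) hN).ne'
          exact (if_neg this).symm
        · rfl
    show @Code.dec K ‹Field K› (Fin N → Kˣ) _ _ = ρ
    rw [this, Code.dec_enc]
  · exact hv
  · have := hh ⟨coin, unitCoin, h, fun _ => 0⟩ rfl
    rw [← zeroAll_eval] at this
    show decide ((Expr.ifZero (zeroAll (errors L h.length)) (.const 1) (.const 0)).eval
      ⟨coin, unitCoin, h, fun _ => 0⟩ ≠ 0) = decide (Clean h)
    rw [Expr.eval]
    by_cases hc : Clean h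
    · simp [this.1 hc, hc, Expr.eval]
    · simp [mt this.2 hc, hc, Expr.eval]

theorem simSteps_fit (L : ℕ → ℕ) {coin unitCoin : ℕ → K} {t : (Fin S.m → Kˣ) × K}
    {t' : (Fin S.dpad → Kˣ) × K} (h1 : ∀ j : Fin S.m, unitCoin (0 + j) = t.1 j)
    (h2 : coin (S.m + S.dpad) = t.2) (h3 : ∀ j : Fin S.dpad, unitCoin (S.m + j) = t'.1 j)
    (h4 : coin (S.m + S.dpad + 1) = t'.2) :
    List.Forall₂ (Fits L coin unitCoin) (hybridSteps S t t') (simSteps S L) := by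
  refine List.rel_append (.cons (silent_fits _ rfl fun _ _ => rfl)
    (.cons (silent_fits _ rfl fun _ _ => rfl) (.cons (silent_fits _ rfl fun _ _ => rfl) .nil)))
    (List.rel_append (macSim_fits L h1 h2) (List.rel_append
      (.cons (silent_fits _ rfl fun _ _ => rfl) ?_) (macSim_fits L h3 h4)))
  generalize List.finRange S.dpad = l
  induction l with
  | nil => exact .nil
  | cons i l ih =>
    rw [List.flatMap_cons, List.flatMap_cons]
    exact List.rel_append (.cons (silent_fits _ rfl fun _ _ => rfl)
      (.cons (silent_fits _ rfl fun _ _ => rfl) (.cons (silent_fits _ rfl fun _ _ => rfl)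
      (.cons (silent_fits _ rfl fun _ _ => rfl) .nil)))) ih

theorem calls_eq (t : (Fin S.m → Kˣ) × K) (t' : (Fin S.dpad → Kˣ) × K) :
    (protocol S).map Step.F
      = (hybridSteps S t t').map HStep.F ++ [Frecon K (Word S.k) S.fo] := by
  have h : ((List.finRange S.dpad).flatMap (iteration S)).map Step.F
      = ((List.finRange S.dpad).flatMap fun _ => iterationHybrid S).map HStep.F := by
    rw [List.map_flatMap, List.map_flatMap]
    rfl
  unfold protocol evalSteps hybridSteps evalHybrid
  simp only [List.map_append, List.map_cons, h, List.append_assoc, List.cons_append, setupSteps,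
    List.nil_append]
  rfl

/-- m + 2 is a crude common bound for the numbers of error coordinates: m in the setup
multiplications, 1 in a MAC check, 2 in a selection. -/
theorem calls_tamperCode (F : Functionality K) (hF : F ∈ (protocol S).map Step.F) :
    ∃ N ≤ S.m + 2, TamperCode F N := by
  have zero (F : Functionality K) (h : ∀ r, ¬F.tampers r) : ∃ N ≤ S.m + 2, TamperCode F N :=
    ⟨0, Nat.zero_le _, fun a => by simp [h]⟩
  have mul (N : ℕ) (hN : N ≤ S.m + 2) : ∃ N' ≤ S.m + 2, TamperCode (Fmul K N) N' := by
    refine ⟨N, hN, fun a => ?_⟩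
    have key (j : Fin N) : @Code.enc K ‹Field K›
        (((Fin N → K) × (Fin N → Sh K)) × (Fin 3 → Bool)) _ a (4 * j) = a.1.1 j := by
      have hN : 0 < N := j.pos
      refine (enc_pair_four (α := Fin N → K) (β := Fin N → Sh K) a j).trans ?_
      rw [enc_tuple, dif_pos hN]
      have h1 : (⟨(j : ℕ) % N, Nat.mod_lt _ hN⟩ : Fin N) = j :=
        Fin.ext (Nat.mod_eq_of_lt j.isLt)
      rw [h1, Nat.div_eq_of_lt j.isLt]
      exact if_pos rfl
    show a.1.1 ≠ 0 ↔ _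
    rw [Function.ne_iff]
    constructor
    · rintro ⟨j, hj⟩
      exact ⟨j, j.isLt, fun H => hj ((key j).symm.trans H)⟩
    · rintro ⟨j, hj, H⟩
      exact ⟨⟨j, hj⟩, fun H' => H ((key ⟨j, hj⟩).trans H')⟩
  have os : ∃ N ≤ S.m + 2, TamperCode (Fos K (Word S.k) (K × K) S.m S.pos) N := by
    refine ⟨2, by omega, fun a => ?_⟩
    have key (j : ℕ) : @Code.enc K ‹Field K›
        (((K × K) × Sh (K × K)) × (Fin 3 → Bool)) _ a (4 * j) = Code.enc a.1.1 j :=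
      enc_pair_four _ _
    have h0 : @Code.enc K ‹Field K› (K × K) _ a.1.1 0 = a.1.1.1 := by
      rw [show 0 = 2 * 0 from rfl, enc_pair_even]
      exact if_pos rfl
    have h1 : @Code.enc K ‹Field K› (K × K) _ a.1.1 1 = a.1.1.2 := by
      rw [show 1 = 2 * 0 + 1 from rfl, enc_pair_odd]
      exact if_pos rfl
    show a.1.1 ≠ 0 ↔ _
    constructor
    · intro H
      by_cases hz : a.1.1.1 = 0
      · refine ⟨1, by omega, fun H' => H (Prod.ext hz ?_)⟩
        exact h1.symm.trans ((key 1).symm.trans H')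
      · exact ⟨0, by omega, fun H' => hz (h0.symm.trans ((key 0).symm.trans H'))⟩
    · rintro ⟨j, hj, H⟩ H'
      refine H ((key j).trans ?_)
      interval_cases j
      · exact h0.trans (by rw [H']; rfl)
      · exact h1.trans (by rw [H']; rfl)
  -- Arbitrary coins: they affect the leaks, not the functionalities called.
  rw [calls_eq (1, 0) (1, 0)] at hF
  simp only [hybridSteps, setupHybrid, macHybrid, evalHybrid, iterationHybrid, List.map_append,
    List.map_cons, List.map_nil, List.mem_append, List.mem_cons, List.not_mem_nil, or_false,
    List.map_flatMap, List.mem_flatMap, List.mem_finRange, true_and] at hF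
  have h1 : (1 : ℕ) ≤ S.m + 2 := by omega
  have hm : S.m ≤ S.m + 2 := by omega
  rcases hF with ((rfl | rfl | rfl) | (rfl | rfl | rfl | rfl | rfl) |
    (rfl | ⟨-, rfl | rfl | rfl | rfl⟩) | rfl | rfl | rfl | rfl | rfl) | rfl
  all_goals first
    | exact os
    | exact mul _ h1
    | exact mul _ hm
    | exact zero _ fun _ h => h

theorem exists_errorCount : ∃ L : ℕ → ℕ, (∀ t, L t ≤ S.m + 2) ∧
    ∀ (t : ℕ) (F : Functionality K), ((protocol S).map Step.F)[t]? = some F →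
      TamperCode F (L t) := by
  have h (t : ℕ) : ∃ N ≤ S.m + 2, ∀ F : Functionality K,
      ((protocol S).map Step.F)[t]? = some F → TamperCode F N := by
    cases hF : ((protocol S).map Step.F)[t]? with
    | none => exact ⟨0, Nat.zero_le _, fun F hF => nomatch hF⟩
    | some F =>
      obtain ⟨N, hN, hT⟩ := calls_tamperCode F (List.mem_of_getElem? hF)
      exact ⟨N, hN, fun F' h => Option.some.inj h ▸ hT⟩
  choose L h1 h2 using h
  exact ⟨L, h1, h2⟩

/-! ### The ideal process is the hybrid process -/

theorem unif_append_bind {G : Type} [Fintype G] [Nonempty G] {Ω : Type*} (a b : ℕ)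
    (f : (Fin (a + b) → G) → PMF Ω) :
    (unif (Fin (a + b) → G)).bind f = (unif (Fin a → G)).bind fun x =>
      (unif (Fin b → G)).bind fun y => f (Fin.append x y) := by
  rw [← unif_bind_equiv (Fin.appendEquiv a b) f, unif_prod_bind]
  rfl

/-- The two checks read disjoint parts of the tape, so their samples are independent; the coins that
nobody reads average out. -/
theorem tape_bind {Ω : Type*} (a b : ℕ)
    (f : (Fin a → Kˣ) × K → (Fin b → Kˣ) × K → PMF Ω) :
    ((unif ((Fin (a + (b + 2)) → K) × (Fin (a + (b + 2)) → Kˣ))).bind fun τ =>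
      f (fun j => τ.2 (Fin.castAdd _ j), τ.1 (Fin.natAdd a (Fin.natAdd b 0)))
        (fun j => τ.2 (Fin.natAdd a (Fin.castAdd 2 j)), τ.1 (Fin.natAdd a (Fin.natAdd b 1))))
      = (unif ((Fin a → Kˣ) × K)).bind fun t => (unif ((Fin b → Kˣ) × K)).bind fun t' =>
        f t t' := by
  rw [unif_prod_bind]
  simp only [unif_append_bind, Fin.append_left, Fin.append_right, PMF.bind_const]
  have h2 (g : K → K → PMF Ω) : ((unif (Fin 2 → K)).bind fun y => g (y 0) (y 1))
      = (unif K).bind fun v => (unif K).bind fun v' => g v v' := by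
    rw [← unif_prod_bind fun q => g q.1 q.2, ← unif_bind_equiv (finTwoArrowEquiv K)]
    rfl
  rw [h2 fun v v' => (unif (Fin a → Kˣ)).bind fun x => (unif (Fin b → Kˣ)).bind fun x' =>
    f (x, v) (x', v')]
  simp only [unif_prod_bind]
  rw [PMF.bind_comm]
  simp only [PMF.bind_comm (unif K) (unif (Fin a → Kˣ))]
  congr 1
  funext x
  rw [PMF.bind_comm]
  congr 1
  funext v
  rw [PMF.bind_comm]

/-- Halting formulas read messages only, so they have the same value before and after the output
becomes known. -/
theorem halt_eval_out (p : Fin 3) (L : ℕ → ℕ) (l : List (SimStep K)) (last : SimStep K) (t : ℕ)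
    (coin unitCoin out : ℕ → K) (h : List (Event K)) :
    ((simulator S p L l last).halt t).eval ⟨coin, unitCoin, h, out⟩ = 0 ↔
      ((simulator S p L l last).halt t).eval ⟨coin, unitCoin, h, fun _ => 0⟩ = 0 := by
  simp only [simulator]
  by_cases h1 : t = 0
  · simp only [if_pos h1, Expr.eval]
  rw [if_neg h1, zeroAll_eval, zeroAll_eval]
  refine forall₂_congr fun x hx => ?_
  have : ∀ x ∈ undelivered (K := K) p (t - 1) ++ errors L (t - 1),
      x.eval ⟨coin, unitCoin, h, out⟩ = x.eval ⟨coin, unitCoin, h, fun _ => 0⟩ := by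
    simp only [undelivered, errors, List.mem_append, List.mem_map, List.mem_flatMap]
    rintro x (⟨i, -, rfl⟩ | ⟨s, -, j, -, rfl⟩)
    · simp only [Expr.eval]
      congr
    · simp only [Expr.eval]
  rw [this x]
  rw [List.mem_append] at hx ⊢
  refine hx.imp_right fun hx => ?_
  by_cases hc : ((l ++ [last])[t - 1]?).elim false SimStep.check = true
  · rwa [if_pos hc] at hx
  · rw [if_neg hc] at hx
    cases hx

theorem evalList_inputExprs (p : Fin 3) (coin unitCoin out : ℕ → K) (h : List (Event K)) :
    evalList ⟨coin, unitCoin, h, out⟩ (inputExprs S p) = evalList ⟨0, 0, h, 0⟩ (inputExprs S p) := by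
  funext j
  unfold inputExprs
  split_ifs
  · simp only [evalList_map_range, Expr.eval]
  · simp only [evalList_map_range, Expr.eval]
  · rfl

theorem reconSim_leak (p : Fin 3) (w : Word S.k) (coin unitCoin : ℕ → K) (h : List (Event K))
    (t : ℕ) :
    (Code.dec (evalList ⟨coin, unitCoin, h, if p = S.fo then Code.enc w else fun _ => 0⟩
      ((reconSim S p).leak t)) : Word S.k) = if some p = some S.fo then w else 0 := by
  unfold reconSim
  by_cases hp : p = S.fo
  · simp only [if_pos hp, if_pos (congrArg some hp)]
    refine (congrArg Code.dec (funext fun j => ?_)).trans (Code.dec_enc (K := K) w)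
    rw [evalList_map_range]
    split_ifs with hj
    · simp only [Expr.eval]
    · exact (enc_word_eq_zero w j (not_lt.1 hj)).symm
  · rw [if_neg hp, if_neg hp, if_neg fun H => hp (Option.some.inj H)]
    funext i
    exact if_pos rfl

/-- The ideal process after the query to the ideal functionality. -/
def idealEnd (sim : Simulator K) (p : Fin 3) (A : Adversary K) (T : S.TreeArray) (X : S.Features)
    (coin unitCoin : ℕ → K) (h : List (Event K)) : PMF (Record S) :=
  let w := S.pdte (treeOf S p T h) (featuresOf S p X h)
  let out : ℕ → K := if p = S.fo then Code.enc w else fun _ => 0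
  (chat sim A coin unitCoin out [Frecon K (Word S.k) S.fo] h).map fun q => (q.1, fun i =>
    if i = p then .done
    else if (sim.deliver i).eval ⟨coin, unitCoin, q.1, out⟩ = 0 then .aborted
    else if i = S.fo then .result w else .done)

/-- If the conversation stops before the reconstruction, the delivery flags of that call evaluate to
the default 0, which withholds every output. -/
theorem idealEnd_of_halt (p : Fin 3) (L : ℕ → ℕ) {l : List (SimStep K)} {last : SimStep K}
    (A : Adversary K) (T : S.TreeArray) (X : S.Features) (coin unitCoin : ℕ → K)
    {h : List (Event K)} (hlen : h.length = l.length)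
    (hh : ((simulator S p L l last).halt h.length).eval ⟨coin, unitCoin, h, fun _ => 0⟩ ≠ 0) :
    idealEnd (simulator S p L l last) p A T X coin unitCoin h = PMF.pure (abortAll p h) := by
  classical
  unfold idealEnd
  simp only [chat, halt_eval_out, if_neg hh, PMF.pure_map]
  have : ∀ i : Fin 3, ((simulator S p L l last).deliver i).eval ⟨coin, unitCoin, h,
      if p = S.fo then Code.enc (S.pdte (treeOf S p T h) (featuresOf S p X h)) else fun _ => 0⟩
        = 0 := by
    intro i
    simp [simulator, Expr.eval, ← hlen]
  simp only [this, if_true]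
  rfl

theorem idealEnd_of_not_halt (p : Fin 3) (L : ℕ → ℕ) {l : List (SimStep K)}
    (A : Adversary K) (T : S.TreeArray) (X : S.Features) (coin unitCoin : ℕ → K)
    {h : List (Event K)} (hlen : h.length = l.length)
    (hh : ((simulator S p L l (reconSim S p)).halt h.length).eval
      ⟨coin, unitCoin, h, fun _ => 0⟩ = 0) :
    idealEnd (simulator S p L l (reconSim S p)) p A T X coin unitCoin h
      = finishHybrid p A T X h := by
  classical
  unfold idealEnd finishHybrid finish
  simp only [chat, halt_eval_out, if_pos hh]
  have hleak : (simulator S p L l (reconSim S p)).leak h.length = (reconSim S p).leak h.length := by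
    simp [simulator, hlen]
  rw [hleak, PMF.map_bind]
  have := reconSim_leak p (S.pdte (treeOf S p T h) (featuresOf S p X h)) coin unitCoin h h.length
  generalize S.pdte (treeOf S p T h) (featuresOf S p X h) = w at this ⊢
  have this' : (haveI := (Frecon K (Word S.k) S.fo).codeLeak
    Code.dec (evalList ⟨coin, unitCoin, h, if p = S.fo then Code.enc w else fun _ => 0⟩
      ((reconSim S p).leak h.length)) : (Frecon K (Word S.k) S.fo).Leak)
      = if some p = some S.fo then w else (0 : Word S.k) := this
  rw [this']
  refine congrArg (PMF.bind _) (funext fun x => ?_)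
  rw [PMF.pure_map]
  refine congrArg PMF.pure (Prod.ext rfl (funext fun i => ?_))
  have hx := eval_delivery (E := ⟨coin, unitCoin, h ++ [⟨Frecon K (Word S.k) S.fo,
    if some p = some S.fo then w else (0 : Word S.k), x⟩],
    if p = S.fo then Code.enc w else fun _ => 0⟩) (t := l.length) (a := x)
    (F := Frecon K (Word S.k) S.fo) (y := if some p = some S.fo then w else (0 : Word S.k))
    (by rw [← hlen]; exact List.getElem?_concat_length) i
  by_cases hi : i = p
  · simp only [if_pos hi, if_pos (congrArg some hi.symm)]
  · have hi' : some p ≠ some i := fun H => hi (Option.some.inj H).symm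
    simp only [if_neg hi, if_neg hi', simulator]
    have hz (e : K) (he : e = if x.2 i = true then 1 else 0) : e = 0 ↔ ¬x.2 i = true := by
      rw [he]
      simp
    refine (if_congr (hz _ hx) rfl rfl).trans ?_
    by_cases hb : x.2 i = true <;> simp [hb]

/-- The equality is exact: all of the statistical error is spent on the MAC checks. By `hplay_bind`
the samples ρ and v of both checks can be drawn at the very start, where they become the random tape
of the simulator. -/
theorem ideal_eq_hybrid {L : ℕ → ℕ} (hL : ∀ (t : ℕ) (F : Functionality K),
    ((protocol S).map Step.F)[t]? = some F → TamperCode F (L t)) (p : Fin 3) (A : Adversary K)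
    (T : S.TreeArray) (X : S.Features) :
    ideal S (some p) (simulator S p L (simSteps S L) (reconSim S p)) A T X = hybrid p A T X := by
  classical
  set sim := simulator S p L (simSteps S L) (reconSim S p) with hsim
  set onAbort : List (Event K) → PMF (Record S) := fun h => PMF.pure (abortAll p h)
  have h1 : hybrid p A T X = (unif ((Fin S.m → Kˣ) × K)).bind fun t =>
      (unif ((Fin S.dpad → Kˣ) × K)).bind fun t' =>
        hplay p A onAbort (hybridSteps S t t') (finishHybrid p A T X) [] := by
    simp only [hybridSteps, hplay_append, hplay_bind]
    rfl
  rw [h1, ← tape_bind]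
  unfold ideal
  simp only
  refine congrArg (PMF.bind _) (funext fun τ => ?_)
  set t : (Fin S.m → Kˣ) × K :=
    (fun j => τ.2 (Fin.castAdd _ j), τ.1 (Fin.natAdd S.m (Fin.natAdd S.dpad 0)))
  set t' : (Fin S.dpad → Kˣ) × K :=
    (fun j => τ.2 (Fin.natAdd S.m (Fin.castAdd 2 j)), τ.1 (Fin.natAdd S.m (Fin.natAdd S.dpad 1)))
  set coin : ℕ → K := fun i => if h : i < sim.coins then τ.1 ⟨i, h⟩ else 0 with hcoin
  set unitCoin : ℕ → K := fun i => if h : i < sim.coins then (τ.2 ⟨i, h⟩ : K) else 0 with hunit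
  have hcoins : sim.coins = S.m + (S.dpad + 2) := rfl
  have hfit : List.Forall₂ (Fits L coin unitCoin) (hybridSteps S t t') (simSteps S L) := by
    refine simSteps_fit L (fun j => ?_) ?_ (fun j => ?_) ?_
    · simp only [hunit]
      rw [dif_pos (by omega)]
      exact congrArg (fun x => (τ.2 x : K)) (Fin.ext (Nat.zero_add (j : ℕ)))
    · simp only [hcoin]
      rw [dif_pos (by omega)]
      rfl
    · simp only [hunit]
      rw [dif_pos (by omega)]
      rfl
    · simp only [hcoin]
      rw [dif_pos (by omega)]
      rfl
  have hq : sim.query = ((hybridSteps S t t').map HStep.F).length := by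
    rw [List.length_map]
    exact hfit.length_eq.symm
  rw [calls_eq t t', hq, List.take_left, List.drop_left]
  rw [← chat_eq_hplay S p A onAbort (finishHybrid p A T X)
    (idealEnd sim p A T X coin unitCoin) (reconSim S p) hfit
    (fun s F hF => hL s F (by
      rw [calls_eq t t']
      exact getElem?_of_prefix (List.prefix_append _ _) hF))
    (fun h hh => ?_) (hybridSteps S t t') [] rfl [] rfl ?_]
  · refine congrArg (PMF.bind _) (funext fun q => ?_)
    by_cases hq2 : q.2 = false
    · rw [if_pos hq2, if_pos hq2]
      rfl
    · rw [if_neg hq2, if_neg hq2]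
      unfold idealEnd treeOf featuresOf
      simp only [← evalList_inputExprs p coin unitCoin (fun _ => 0) q.1]
      rfl
  · rfl
  · have hlen : h.length = (simSteps S L).length := by
      rw [← hfit.length_eq, ← List.length_map (f := HStep.F), ← hh, List.length_map]
    exact ⟨idealEnd_of_not_halt p L A T X coin unitCoin hlen,
      idealEnd_of_halt p L A T X coin unitCoin hlen⟩

end Concrete

section Size

variable {K : Type} [Field K] [Fintype K] [DecidableEq K] {S : Setting K}

/-! ### The size of the simulator -/

theorem sum_size_le {l : List (Expr K)} {B : ℕ} (hB : ∀ e ∈ l, e.size ≤ B) :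
    (l.map Expr.size).sum ≤ l.length * B := by
  have := List.sum_le_card_nsmul (l.map Expr.size) B (by simpa using hB)
  simpa using this

theorem zeroAll_size_le {l : List (Expr K)} {B : ℕ} (hB : ∀ e ∈ l, e.size ≤ B) :
    (zeroAll l).size ≤ l.length * (B + 2) + 1 := by
  induction l with
  | nil => simp [zeroAll, Expr.size]
  | cons e l ih =>
    have h1 := hB e List.mem_cons_self
    have h2 := ih fun x hx => hB x (List.mem_cons_of_mem _ hx)
    simp only [zeroAll, Expr.size, List.length_cons]
    linarith

theorem errors_size {L : ℕ → ℕ} {t : ℕ} : ∀ e ∈ errors (K := K) L t, e.size ≤ 1 := by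
  simp only [errors, List.mem_flatMap, List.mem_map]
  rintro e ⟨s, -, j, -, rfl⟩
  exact le_rfl

theorem errors_length_le {L : ℕ → ℕ} {B : ℕ} (hL : ∀ t, L t ≤ B) (t : ℕ) :
    (errors (K := K) L t).length ≤ t * B := by
  rw [errors, List.length_flatMap]
  have := List.sum_le_card_nsmul ((List.range t).map fun s =>
    ((List.range (L s)).map fun j => Expr.msg (K := K) s (4 * j)).length) B (by
      simpa using fun s (_ : s < t) => hL s)
  simpa using this

theorem undelivered_length_le (p : Fin 3) (t : ℕ) : (undelivered (K := K) p t).length ≤ 3 := by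
  rw [undelivered, List.length_map]
  exact (List.length_filter_le _ _).trans (by simp)

theorem protocol_length : (protocol S).length = 4 * S.dpad + 15 := by
  have h : ((List.finRange S.dpad).flatMap (iteration S)).length = 4 * S.dpad := by
    rw [List.length_flatMap]
    have : (fun j => (iteration S j).length) = fun _ => 4 := rfl
    rw [this]
    simp [mul_comm]
  simp only [protocol, setupSteps, evalSteps, macCheck, List.length_append, h, List.length_cons,
    List.length_nil]
  ring

/-- There are at most three delivery tests, each of size 4, and at most t·B error coordinates. Each
formula costs at most 4 + 2, so the total is at most 6(3 + tB) + 1; the coefficient 18 leaves room.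
-/
theorem halt_size_le {L : ℕ → ℕ} {B : ℕ} (hL : ∀ t, L t ≤ B) (p : Fin 3) (l : List (SimStep K))
    (last : SimStep K) (t : ℕ) :
    ((simulator S p L l last).halt t).size ≤ 19 + 18 * (t * B) := by
  simp only [simulator]
  split_ifs with ht hc
  · simp only [Expr.size]
    omega
  all_goals
    refine (zeroAll_size_le (B := 4) fun e he => ?_).trans ?_
    · rcases List.mem_append.1 he with he | he
      · simp only [undelivered, List.mem_map] at he
        obtain ⟨i, -, rfl⟩ := he
        exact le_rfl
      · first
        | exact (errors_size e he).trans (by norm_num)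
        | cases he
    · have h1 := undelivered_length_le (K := K) p (t - 1)
      have h2 := (errors_length_le (K := K) hL (t - 1)).trans
        (Nat.mul_le_mul_right B (Nat.sub_le t 1))
      simp only [List.length_append, List.length_nil]
      omega

theorem macSim_size_le {L : ℕ → ℕ} {B : ℕ} (hL : ∀ t, L t ≤ B) (N b b' t : ℕ) :
    ∀ e ∈ macSim (K := K) L N b b', ((e.leak t).map Expr.size).sum ≤ N + 4 + 3 * (t * B) := by
  have h1 := zeroAll_size_le (errors_size (K := K) (L := L) (t := t))
  have h2 := errors_length_le (K := K) hL t
  intro e he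
  simp only [macSim, List.mem_cons, List.not_mem_nil, or_false] at he
  rcases he with rfl | rfl | rfl | rfl | rfl
  · exact Nat.zero_le _
  · exact Nat.zero_le _
  · refine (sum_size_le (B := 1) fun e he => ?_).trans (by simp; omega)
    obtain ⟨i, -, rfl⟩ := List.mem_map.1 he
    exact le_rfl
  · simp only [List.map_cons, List.map_nil, List.sum_cons, List.sum_nil, Expr.size]
    omega
  · simp only [List.map_cons, List.map_nil, List.sum_cons, List.sum_nil, Expr.size]
    omega

theorem leak_size_le {L : ℕ → ℕ} {B : ℕ} (hL : ∀ t, L t ≤ B) (p : Fin 3) (t : ℕ) :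
    ((((simulator S p L (simSteps S L) (reconSim S p)).leak t).map Expr.size).sum)
      ≤ (S.m + S.dpad + S.k) + 4 + 3 * (t * B) := by
  have key : ∀ e ∈ simSteps S L ++ [reconSim S p],
      ((e.leak t).map Expr.size).sum ≤ (S.m + S.dpad + S.k) + 4 + 3 * (t * B) := by
    intro e he
    simp only [simSteps, List.mem_append, List.mem_cons, List.not_mem_nil, or_false,
      List.mem_flatMap] at he
    have silent_le : e = silent →
        ((e.leak t).map Expr.size).sum ≤ (S.m + S.dpad + S.k) + 4 + 3 * (t * B) := by
      rintro rfl
      exact Nat.zero_le _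
    rcases he with ((h | h | h) | h | (h | ⟨-, -, h | h | h | h⟩) | h) | rfl
    iterate 3 exact silent_le h
    · exact (macSim_size_le hL _ _ _ t e h).trans (by omega)
    iterate 5 exact silent_le h
    · exact (macSim_size_le hL _ _ _ t e h).trans (by omega)
    · simp only [reconSim]
      split_ifs
      · refine (sum_size_le (B := 1) fun e he => ?_).trans (by simp; omega)
        obtain ⟨i, -, rfl⟩ := List.mem_map.1 he
        exact le_rfl
      · exact Nat.zero_le _
  simp only [simulator]
  cases h : (simSteps S L ++ [reconSim S p])[t]? with
  | none => exact Nat.zero_le _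
  | some e => exact key e (List.mem_of_getElem? h)

theorem input_size_le (p : Fin 3) :
    ((inputExprs S p).map Expr.size).sum ≤ S.m + S.n * S.k := by
  have h : ∀ e ∈ inputExprs S p, e.size ≤ 1 := by
    unfold inputExprs
    split_ifs <;> simp [Expr.size]
  refine (sum_size_le h).trans ?_
  unfold inputExprs
  split_ifs <;> simp

/-- A bound for the size of the simulator. -/
def sizeBound : Polynomial ℕ :=
  (Polynomial.X + 2) + (4 * Polynomial.X + 15) * (23 + Polynomial.X
    + 21 * ((4 * Polynomial.X + 15) * (Polynomial.X + 2)))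
    + (Polynomial.X + Polynomial.X * Polynomial.X) + 3

theorem simulator_size_le {L : ℕ → ℕ} (hL : ∀ t, L t ≤ S.m + 2) (p : Fin 3) :
    (simulator S p L (simSteps S L) (reconSim S p)).size (protocol S).length
      ≤ sizeBound.eval (S.m + S.n + S.k + S.dpad) := by
  generalize hs : S.m + S.n + S.k + S.dpad = s
  have hev : sizeBound.eval s = (s + 2) + (4 * s + 15) * (23 + s
      + 21 * ((4 * s + 15) * (s + 2))) + (s + s * s) + 3 := by
    simp [sizeBound]
  rw [hev, Simulator.size, protocol_length]
  have h1 : (simulator S p L (simSteps S L) (reconSim S p)).coins ≤ s + 2 := by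
    simp only [simulator]
    omega
  have h2 : ((simulator S p L (simSteps S L) (reconSim S p)).input.map Expr.size).sum
      ≤ s + s * s :=
    (input_size_le p).trans (Nat.add_le_add (by omega) (Nat.mul_le_mul (by omega) (by omega)))
  have h3 : ∑ i, ((simulator S p L (simSteps S L) (reconSim S p)).deliver i).size ≤ 3 := by
    simp [simulator, Expr.size]
  have h4 : ∑ t ∈ Finset.range (4 * S.dpad + 15),
      (((simulator S p L (simSteps S L) (reconSim S p)).halt t).size
        + (((simulator S p L (simSteps S L) (reconSim S p)).leak t).map Expr.size).sum)
      ≤ (4 * s + 15) * (23 + s + 21 * ((4 * s + 15) * (s + 2))) := by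
    -- 23 = 19 + 4 and 21 = 18 + 3 combine the bounds for the halting test and the leak of one call.
    refine (Finset.sum_le_card_nsmul _ _ (23 + s + 21 * ((4 * s + 15) * (s + 2)))
      fun t ht => ?_).trans ?_
    · have ht' := Finset.mem_range.1 ht
      have a := halt_size_le hL p (S := S) (simSteps S L) (reconSim S p) t
      have b := leak_size_le hL p (S := S) t
      have c : t * (S.m + 2) ≤ (4 * s + 15) * (s + 2) :=
        Nat.mul_le_mul (by omega) (by omega)
      omega
    · rw [Finset.card_range, smul_eq_mul]
      exact Nat.mul_le_mul_right _ (by omega)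
  omega

end Size

section Trees

variable {K : Type} [Field K] {S : Setting K}

/-! ### The meaning of the functionality -/

/-- The node reached from position `i` after `j` comparisons. -/
def walkFrom (T : S.TreeArray) (X : S.Features) (i : Fin S.m) : ℕ → K
  | 0 => T i
  | j + 1 =>
    let x := T i
    walkFrom T X (S.pos (if (S.innerProd (X, S.sel x)).val < (S.thr x).val then S.left x
      else S.right x)) j

/-- `walkFrom` takes comparisons off the front, as induction on the tree requires, whereas `walk`
appends them at the end; this reconciles the two. -/
theorem walkFrom_succ (T : S.TreeArray) (X : S.Features) (i : Fin S.m) (j : ℕ) :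
    walkFrom T X i (j + 1) = T (S.pos (if (S.innerProd (X, S.sel (walkFrom T X i j))).val
      < (S.thr (walkFrom T X i j)).val then S.left (walkFrom T X i j)
      else S.right (walkFrom T X i j))) := by
  induction j generalizing i with
  | zero => rfl
  | succ j ih => exact ih _

theorem walk_eq_walkFrom (T : S.TreeArray) (X : S.Features) (j : ℕ) :
    S.walk T X j = walkFrom T X ⟨0, Nat.two_pow_pos _⟩ j := by
  induction j with
  | zero => rfl
  | succ j ih => rw [walkFrom_succ, ← ih, Setting.walk]

theorem pos_of_val_eq {w : Word S.k} {i : Fin S.m} (h : w.val = i) : S.pos w = i :=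
  Fin.ext ((congrArg (· % 2 ^ S.lm) h).trans (Nat.mod_eq_of_lt i.isLt))

theorem innerProd_single (X : S.Features) (v : Fin S.n) :
    S.innerProd (X, Pi.single v 1) = X v := by
  simp [Setting.innerProd, Pi.single_apply]

/-- A comparison at an inner node leads to the root of the right subtree to classify with, and a
leaf is a fixed point of the walk, so surplus comparisons do no harm. -/
theorem cls_walkFrom {T : S.TreeArray} (X : S.Features) {𝒯 : DTree S.k S.n} {i : Fin S.m}
    (h : S.Encodes T 𝒯 i) {d : ℕ} (hd : 𝒯.depth ≤ d) :
    S.cls (walkFrom T X i d) = 𝒯.classify X := by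
  induction 𝒯 generalizing i d with
  | leaf c =>
    obtain ⟨hc, hl, hr⟩ := h
    have : ∀ d, walkFrom T X i d = T i := by
      intro d
      induction d with
      | zero => rfl
      | succ d ih =>
        rw [walkFrom]
        simp only [apply_ite S.pos, pos_of_val_eq hl, pos_of_val_eq hr, ite_self]
        exact ih
    rw [this, hc]
    rfl
  | node t v l r ihl ihr =>
    obtain ⟨ht, hv, a, b, ha, hb, hl, hr⟩ := h
    rw [DTree.depth] at hd
    obtain ⟨d, rfl⟩ := Nat.exists_eq_succ_of_ne_zero (show d ≠ 0 by omega)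
    rw [walkFrom, DTree.classify]
    simp only [apply_ite S.pos, pos_of_val_eq ha, pos_of_val_eq hb, ht, hv, innerProd_single]
    split_ifs
    · exact ihl hl (by omega)
    · exact ihr hr (by omega)

theorem pdte_eq_classify {𝒯 : DTree S.k S.n} {T : S.TreeArray} (X : S.Features)
    (hd : 𝒯.depth < S.dpad) (h : S.Encodes T 𝒯 ⟨0, Nat.two_pow_pos _⟩) :
    S.pdte T X = 𝒯.classify X := by
  rw [Setting.pdte, walk_eq_walkFrom]
  exact cls_walkFrom X h hd.le

end Trees

section Error

variable {K : Type} [Field K] [Fintype K] {S : Setting K}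

/-! ### The error -/

theorem card_eq (S : Setting K) : Fintype.card K = 2 ^ S.ell := by
  rw [Fintype.card_congr S.bits.toEquiv]
  simp [Setting.ell, ZMod.card]

/-- Two checks at 1/q + 2/q each: the origin of the constant 6. -/
theorem macError_add_self : macError K + macError K = ENNReal.ofReal (6 / Fintype.card K) := by
  have h : (0 : ℝ) < Fintype.card K := Nat.cast_pos.2 Fintype.card_pos
  rw [ENNReal.ofReal_div_of_pos h, ENNReal.ofReal_natCast, macError, ← ENNReal.add_div,
    ← ENNReal.add_div]
  congr 1
  norm_num

theorem error_lt {lam : ℕ} (h : lam < S.ell) : (6 : ℝ) / Fintype.card K < 6 / 2 ^ lam := by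
  rw [card_eq S, Nat.cast_pow, Nat.cast_ofNat]
  exact div_lt_div_of_pos_left (by norm_num) (by positivity) (pow_lt_pow_right₀ (by norm_num) h)

variable [DecidableEq K]

theorem undetected_le (c : Fin 3) (A : Adversary K) (T : S.TreeArray) (X : S.Features) :
    ((real S (some c) A T X).toOuterMeasure (undetected S c)).toReal ≤ 6 / Fintype.card K := by
  have h := real_within_hybrid c A T X
  rw [macError_add_self] at h
  have := h.statClose (by positivity) (undetected S c)
  rw [hybrid_undetected, ENNReal.toReal_zero, sub_zero] at this
  exact (le_abs_self _).trans this

theorem securelyComputes (S : Setting K) :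
    SecurelyComputes S (sizeBound.eval (S.m + S.n + S.k + S.dpad)) (6 / Fintype.card K) := by
  obtain ⟨L, h1, h2⟩ := exists_errorCount (S := S)
  rintro (- | p)
  -- With nobody corrupted the ideal process never consults the simulator, so any one of admissible
  -- size serves.
  · refine ⟨_, simulator_size_le h1 0, fun A T X => ?_⟩
    rw [real_honest]
    exact Within.statClose (by positivity) (Within.of_eq rfl _)
  · refine ⟨_, simulator_size_le h1 p, fun A T X => ?_⟩
    rw [ideal_eq_hybrid h2]
    exact Within.statClose (by positivity) (macError_add_self (K := K) ▸ real_within_hybrid p A T X)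

end Error

end Mostree

end

theorem mainTheorem3 :
    ∃ (C : ℝ) (poly : Polynomial ℕ), 0 < C ∧
      ∀ (K : Type) [Field K] [Fintype K] [DecidableEq K] (S : Mostree.Setting K) (lam : ℕ),
        lam < S.ell →
        Mostree.SecurelyComputes S (poly.eval (S.m + S.n + S.k + S.dpad)) (C / Fintype.card K) ∧
        C / Fintype.card K < C / 2 ^ lam ∧
        (∀ (c : Fin 3) (A : Mostree.Adversary K) (T : S.TreeArray) (X : S.Features),
          ((Mostree.real S (some c) A T X).toOuterMeasure (Mostree.undetected S c)).toReal
            ≤ C / Fintype.card K) ∧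
        (∀ (𝒯 : Mostree.DTree S.k S.n) (T : S.TreeArray) (X : S.Features),
          𝒯.depth < S.dpad → S.Encodes T 𝒯 ⟨0, Nat.two_pow_pos _⟩ →
            S.pdte T X = 𝒯.classify X) := by
  refine ⟨6, Mostree.sizeBound, by norm_num, fun K _ _ _ S lam hlam => ⟨?_, ?_, ?_, ?_⟩⟩
  · exact Mostree.securelyComputes S
  · exact Mostree.error_lt hlam
  · exact fun c A T X => Mostree.undetected_le c A T X
  · exact fun 𝒯 T X hd h => Mostree.pdte_eq_classify X hd h
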